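/- Let $\ln\Gamma$ be the analytic function on $\mathbb{C}\setminus(-\infty,0]$ that equals $\log(\Gamma(x))\in\mathbb{R}$ for real $x>0$, let $\log$ be the principal logarithm, and let $B_n$ be the Bernoulli numbers. For integers $j,k\ge 1$ and $z\in\mathbb{C}\setminus(-\infty,0]$ put $$T_j(z)=\frac{B_{2j}}{2j(2j-1)z^{2j-1}},$$ and let $R_k(z)$ be the remainder in Stirling's approximation, $$\ln\Gamma(z)=(z-\tfrac12)\log z-z+\tfrac12\log(2\pi)+\sum_{j=1}^{k-1}T_j(z)+R_k(z).$$ Put $\widehat T_j(z)=T_j(2z)-T_j(z)$ and $\widehat R_k(z)=R_k(2z)-R_k(z)$ and, for real $t>0$, $$\widetilde T_j(t)=\tfrac12|\widehat T_j(t)|,\qquad \widetilde R_k(t)=\Im\bigl(\tfrac12\widehat R_k(it)\bigr),\qquad \eta_k=\frac1{1-2^{1-2k}}.$$ Let $\vartheta(t)=\arg\Gamma(\tfrac{it}{2}+\tfrac14)-\tfrac t2\log\pi$ be the Riemann--Siegel theta function, where the argument is chosen so that $\vartheta$ is continuous on $\mathbb{R}$ and $\vartheta(0)=0$, and put $$S_k(t)=\frac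 t2\log\Bigl(\frac{t}{2\pi e}\Bigr)-\frac{\pi}{8}+\sum_{j=1}^{k}\widetilde T_j(t).$$ Then for every integer $k\ge1$ and every real $t>0$: 1. $\displaystyle\left|\frac{\widetilde R_{k+1}(t)}{\widetilde T_k(t)}\right|<\eta_k\sqrt{\pi k}$. 2. If in addition $t\ge k$, then $\displaystyle\left|\frac{\widetilde R_{k+1}(t)}{\widetilde T_k(t)}\right|<\eta_k\,\frac{(k/t)^2}{\pi^2-1}$. 3. $\vartheta(t)=S_k(t)+\tfrac12\arctan(e^{-\pi t})+\widetilde R_{k+1}(t)$, and if the arctan term is omitted from this approximation, the error bounds increase by at most $\tfrac12e^{-\pi t}$: $$|\vartheta(t)-S_k(t)|<|\widetilde R_{k+1}(t)|+\tfrac12e^{-\pi t},\qquad |\vartheta(t)-S_k(t)|<\eta_k\sqrt{\pi k}\;\widetilde T_k(t)+\tfrac12e^{-\pi t},$$ and, if $t\ge k$, $$|\vartheta(t)-S_k(t)|<\eta_k\,\frac{(k/t)^2}{\pi^2-1}\;\widetilde T_k(t)+\tfrac12e^{-\pi t}.$$ -/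

import Mathlib

namespace SiegelTheta

noncomputable section

/-! ### The logarithm of the Gamma function -/

/-- The principal branch of the log-Gamma function on the cut plane `ℂ \ (-∞, 0]`: the primitive of
`Γ'/Γ` that vanishes at `1`, i.e. the integral of `Γ'/Γ` along the segment from `1` to `z`.  By
`differentiableOn_lnGamma` and `lnGamma_ofReal` below it is the analytic function on the cut plane
with `lnGamma x = log (Γ x)` for real `x > 0`. -/
def lnGamma (z : ℂ) : ℂ :=
  ∫ s in (0 : ℝ)..1, Complex.digamma (1 + (s : ℂ) * (z - 1)) * (z - 1)

theorem ne_neg_nat_of_mem_slitPlane {z : ℂ} (hz : z ∈ Complex.slitPlane) (m : ℕ) : z ≠ -m := by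
  rintro rfl
  rw [Complex.mem_slitPlane_iff] at hz
  have hm : (0 : ℝ) ≤ m := m.cast_nonneg
  rcases hz with h | h <;> simp at h
  linarith

theorem differentiableOn_Gamma_slitPlane : DifferentiableOn ℂ Complex.Gamma Complex.slitPlane :=
  fun _ hz => (Complex.differentiableAt_Gamma _
    (ne_neg_nat_of_mem_slitPlane hz)).differentiableWithinAt

theorem differentiableOn_digamma_slitPlane :
    DifferentiableOn ℂ Complex.digamma Complex.slitPlane := by
  have h : DifferentiableOn ℂ (fun z => deriv Complex.Gamma z / Complex.Gamma z)
      Complex.slitPlane :=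
    (differentiableOn_Gamma_slitPlane.deriv Complex.isOpen_slitPlane).div
      differentiableOn_Gamma_slitPlane
      (fun z hz => Complex.Gamma_ne_zero (ne_neg_nat_of_mem_slitPlane hz))
  exact h

theorem hasDerivAt_lnGamma {z : ℂ} (hz : z ∈ Complex.slitPlane) :
    HasDerivAt lnGamma (Complex.digamma z) z := by
  obtain ⟨r, hr, hball⟩ := Metric.isOpen_iff.1 Complex.isOpen_slitPlane z hz
  set s : Set ℂ := convexJoin ℝ {1} (Metric.ball z r) with hs_def
  have hs : Convex ℝ s := (convex_singleton 1).convexJoin (convex_ball z r)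
  have hsub : s ⊆ Complex.slitPlane := by
    intro x hx
    obtain ⟨a, ha, b, hb, hx⟩ := mem_convexJoin.1 hx
    rw [Set.mem_singleton_iff] at ha
    subst ha
    exact (starConvex_iff_segment_subset.1 Complex.starConvex_one_slitPlane) (hball hb) hx
  have h1 : (1 : ℂ) ∈ s :=
    subset_convexJoin_left (Metric.nonempty_ball.2 hr) (Set.mem_singleton _)
  have hbs : Metric.ball z r ⊆ s := subset_convexJoin_right (Set.singleton_nonempty _)
  have hzs : z ∈ s := hbs (Metric.mem_ball_self hr)
  have hnhds : s ∈ nhds z := Filter.mem_of_superset (Metric.ball_mem_nhds z hr) hbs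
  have hprim := hs.hasFDerivWithinAt_curveIntegral_segment_of_hasFDerivWithinAt_symmetric
    (ω := fun w => ContinuousLinearMap.smulRightL ℂ ℂ ℂ 1 (Complex.digamma w))
    (fun a ha => (ContinuousLinearMap.smulRightL ℂ ℂ ℂ 1).hasFDerivAt
      |>.comp_hasDerivWithinAt a
        ((differentiableOn_digamma_slitPlane.mono hsub) a ha).hasDerivWithinAt
      |>.restrictScalars ℝ)
    (by rintro a ha x - y -; simpa using by ring) h1 hzs
  have hfun : lnGamma = fun b => curveIntegral
      (fun w => ContinuousLinearMap.smulRightL ℂ ℂ ℂ 1 (Complex.digamma w))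
      (Path.segment 1 b) := by
    funext b
    rw [curveIntegral_segment, lnGamma]
    refine intervalIntegral.integral_congr fun t _ => ?_
    simp [AffineMap.lineMap_apply, mul_comm, add_comm]
  rw [hfun]
  have h := (hprim.hasFDerivAt hnhds).hasDerivAt
  simpa using h

theorem differentiableOn_lnGamma : DifferentiableOn ℂ lnGamma Complex.slitPlane :=
  fun _ hz => (hasDerivAt_lnGamma hz).differentiableAt.differentiableWithinAt

theorem lnGamma_one : lnGamma 1 = 0 := by
  simp [lnGamma]

theorem exp_lnGamma {z : ℂ} (hz : z ∈ Complex.slitPlane) :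
    Complex.exp (lnGamma z) = Complex.Gamma z := by
  have hG : ∀ w ∈ Complex.slitPlane, Complex.Gamma w ≠ 0 := fun w hw =>
    Complex.Gamma_ne_zero (ne_neg_nat_of_mem_slitPlane hw)
  have hd : ∀ w ∈ Complex.slitPlane,
      HasDerivAt (fun w => Complex.Gamma w * Complex.exp (-lnGamma w)) 0 w := by
    intro w hw
    have h1 := (Complex.differentiableAt_Gamma w (ne_neg_nat_of_mem_slitPlane hw)).hasDerivAt
    refine (h1.mul (hasDerivAt_lnGamma hw).neg.cexp).congr_deriv ?_
    rw [Complex.digamma_def, logDeriv_apply]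
    have := hG w hw
    field_simp
    ring
  have hc : Complex.Gamma z * Complex.exp (-lnGamma z) = 1 := by
    have := Complex.isOpen_slitPlane.is_const_of_deriv_eq_zero
      (f := fun w => Complex.Gamma w * Complex.exp (-lnGamma w))
      (Complex.starConvex_one_slitPlane.isPathConnected
        Complex.one_mem_slitPlane).isConnected.isPreconnected
      (fun w hw => (hd w hw).differentiableAt.differentiableWithinAt)
      (fun w hw => (hd w hw).deriv) hz Complex.one_mem_slitPlane
    simpa [lnGamma_one] using this
  rw [Complex.exp_neg, mul_inv_eq_one₀ (Complex.exp_ne_zero _)] at hc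
  exact hc.symm

theorem lnGamma_ofReal {x : ℝ} (hx : 0 < x) :
    lnGamma (x : ℂ) = ((Real.log (Real.Gamma x) : ℝ) : ℂ) := by
  have hmem : ∀ y : ℝ, 0 < y → (y : ℂ) ∈ Complex.slitPlane := fun y hy =>
    Complex.ofReal_mem_slitPlane.2 hy
  have hdΓ : ∀ y : ℝ, 0 < y → HasDerivAt (fun y : ℝ => ((Real.log (Real.Gamma y) : ℝ) : ℂ))
      (Complex.digamma y) y := by
    intro y hy
    have hR : HasDerivAt Real.Gamma (deriv Real.Gamma y) y :=
      (Real.differentiableAt_Gamma (fun m => by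
        have : (0 : ℝ) ≤ m := m.cast_nonneg
        linarith)).hasDerivAt
    have hC : HasDerivAt (fun y : ℝ => Complex.Gamma y) (deriv Complex.Gamma y) y :=
      (Complex.differentiableAt_Gamma _
        (ne_neg_nat_of_mem_slitPlane (hmem y hy))).hasDerivAt.comp_ofReal
    have hC' : HasDerivAt (fun y : ℝ => Complex.Gamma y) ((deriv Real.Gamma y : ℝ) : ℂ) y := by
      simpa [Complex.Gamma_ofReal] using hR.ofReal_comp
    have hl := (hR.log (Real.Gamma_pos_of_pos hy).ne').ofReal_comp
    convert hl using 1
    rw [Complex.digamma_def, logDeriv_apply, hC.unique hC', Complex.Gamma_ofReal]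
    push_cast
    rfl
  have hd : ∀ y ∈ Set.Ioi (0 : ℝ), HasDerivAt
      (fun y : ℝ => lnGamma y - ((Real.log (Real.Gamma y) : ℝ) : ℂ)) 0 y := by
    intro y hy
    exact ((hasDerivAt_lnGamma (hmem y hy)).comp_ofReal.sub (hdΓ y hy)).congr_deriv (sub_self _)
  have := isOpen_Ioi.is_const_of_deriv_eq_zero isPreconnected_Ioi
    (fun y hy => (hd y hy).differentiableAt.differentiableWithinAt)
    (fun y hy => (hd y hy).deriv) (Set.mem_Ioi.2 hx) (Set.mem_Ioi.2 one_pos)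
  simpa [lnGamma_one, sub_eq_zero] using this

/-! ### Stirling's and Gauss's expansions with remainder -/

/-- `T_j(z) = B_{2j} / (2j (2j-1) z^{2j-1})`, for `j ≥ 1`. -/
def T (j : ℕ) (z : ℂ) : ℂ :=
  ((bernoulli (2 * j) : ℚ) : ℂ) / (2 * (j : ℂ) * (2 * (j : ℂ) - 1) * z ^ (2 * j - 1))

/-- The remainder `R_k(z)`, for `k ≥ 1`, in Stirling's approximation
`ln Γ(z) = (z - 1/2) log z - z + (1/2) log (2π) + ∑_{j=1}^{k-1} T_j(z) + R_k(z)`. -/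
def R (k : ℕ) (z : ℂ) : ℂ :=
  lnGamma z - ((z - 1 / 2) * Complex.log z - z + 1 / 2 * Complex.log (2 * (Real.pi : ℂ))
    + ∑ j ∈ Finset.Ico 1 k, T j z)

/-- `T̂_j(z) = T_j(2z) - T_j(z)`. -/
def THat (j : ℕ) (z : ℂ) : ℂ := T j (2 * z) - T j z

/-- `R̂_k(z) = R_k(2z) - R_k(z)`, the remainder in Gauss's approximation
`ln Γ(z + 1/2) = z log z - z + (1/2) log (2π) + ∑_{j=1}^{k-1} T̂_j(z) + R̂_k(z)`. -/
def RHat (k : ℕ) (z : ℂ) : ℂ := R k (2 * z) - R k z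

/-! ### The Riemann-Siegel theta function -/

/-- The Riemann-Siegel theta function `ϑ(t) = arg Γ(it/2 + 1/4) - (t/2) log π`, the argument being
the one that is continuous in `t` and makes `ϑ(0) = 0`. -/
def theta (t : ℝ) : ℝ :=
  (lnGamma (Complex.I * (t : ℂ) / 2 + 1 / 4)).im - t / 2 * Real.log Real.pi

theorem arg_mem_slitPlane (t : ℝ) : Complex.I * (t : ℂ) / 2 + 1 / 4 ∈ Complex.slitPlane := by
  rw [Complex.mem_slitPlane_iff]
  left
  simp

theorem continuous_theta : Continuous theta := by
  have h : Continuous fun t : ℝ => lnGamma (Complex.I * (t : ℂ) / 2 + 1 / 4) :=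
    differentiableOn_lnGamma.continuousOn.comp_continuous (by fun_prop) arg_mem_slitPlane
  exact (Complex.continuous_im.comp h).sub (by fun_prop)

theorem theta_zero : theta 0 = 0 := by
  have h := lnGamma_ofReal (x := 1 / 4) (by norm_num)
  push_cast at h
  simp only [theta, Complex.ofReal_zero, mul_zero, zero_div, zero_add, h, Complex.ofReal_im,
    zero_mul, sub_zero]

theorem theta_spec (t : ℝ) :
    (‖Complex.Gamma (Complex.I * (t : ℂ) / 2 + 1 / 4)‖ : ℂ) *
        Complex.exp (((theta t + t / 2 * Real.log Real.pi : ℝ) : ℂ) * Complex.I) =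
      Complex.Gamma (Complex.I * (t : ℂ) / 2 + 1 / 4) := by
  rw [← exp_lnGamma (arg_mem_slitPlane t), Complex.norm_exp, Complex.ofReal_exp,
    ← Complex.exp_add, theta, sub_add_cancel, Complex.re_add_im]

/-- `T̃_j(t) = (1/2) |T̂_j(t)|`. -/
def TTilde (j : ℕ) (t : ℝ) : ℝ := 1 / 2 * ‖THat j (t : ℂ)‖

/-- `R̃_k(t) = Im ((1/2) R̂_k(it))`. -/
def RTilde (k : ℕ) (t : ℝ) : ℝ := (1 / 2 * RHat k (Complex.I * (t : ℂ))).im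

/-- The approximation `(t/2) log (t/(2πe)) - π/8 + ∑_{j=1}^{k} T̃_j(t)` to `ϑ(t)`, in which the term
`(1/2) arctan (e^{-πt})` is omitted. -/
def thetaApprox (k : ℕ) (t : ℝ) : ℝ :=
  t / 2 * Real.log (t / (2 * Real.pi * Real.exp 1)) - Real.pi / 8
    + ∑ j ∈ Finset.Icc 1 k, TTilde j t

/-- `η_k = 1 / (1 - 2^{1-2k})`. -/
def eta (k : ℕ) : ℝ := 1 / (1 - (2 : ℝ) ^ (1 - 2 * (k : ℤ)))

end

end SiegelTheta

namespace SiegelTheta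

open Real Set Filter Topology MeasureTheory

/-! Let s = it/2 + 1/4. The duplication formula gives the sum of the arguments of Γ(s) and Γ(s +
1/2) in terms of Γ(it + 1/2). The reflection formula gives their difference, because 1 - s is the
conjugate of s + 1/2; the arctan enters as part of the argument of sin πs. Half the sum of the two
expresses ϑ(t) through Im ln Γ(it + 1/2) (`theta_eq`).

Gauss's form of Stirling's formula (`lnGamma_add_half`) then applies with z = it, on the boundary of
the right half plane. Its remainder is an integral of the periodic function B₂({u + 1/2}) + 1/12
against (u + z)⁻². Integration by parts identifies R̂_{k+1}(z) with -(1/2k) ∫₀^∞ B_{2k}({u + 1/2})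
(u + z)^{-2k} du (`RHat_succ_eq`). On the imaginary axis every T̂_j/2 has positive imaginary part
T̃_j, which yields the exact formula for ϑ. The omitted arctan costs less than e^{-πt}/2 because 0 <
arctan x < x for x > 0.

For the first bound, |B_{2k}(x)| ≤ |B_{2k}| on [0, 1] and |u + it|² = u² + t². The integral of (u² +
t²)^{-k} is a Gamma quotient, and log-convexity of Γ puts the resulting factor `gammaRatio k` below
√(πk). The factor η_k turns T̃_k into |T_k|/2, the quantity `halfAbsT` that this estimate produces.

For the second bound, put a_j = |R̃_{j+1}| / (|T_j|/2). Splitting off one term and using ζ(2j+2) ≤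
ζ(2j) gives a_j ≤ j(j - 1/2)/(πt)² · (1 + a_{j+1}), while a_j ≤ `gammaRatio j` by the first
estimate. With t replaced by k ≤ t, these two facts alone imply the claim (`lt_of_recurrence`): by
finite rational computation for k ≤ 7, and by a supersolution of the recurrence for k ≥ 8. -/

/-! ### Even Bernoulli numbers through zeta values. -/

theorem hasSum_zeta_even {k : ℕ} (hk : k ≠ 0) :
    HasSum (fun n : ℕ => 1 / (n : ℝ) ^ (2 * k))
      ((-1 : ℝ) ^ (k + 1) * ((2 * π) ^ (2 * k) / 2 / (2 * k).factorial) * bernoulli (2 * k)) := by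
  convert hasSum_zeta_nat hk using 1
  rw [mul_pow]
  obtain ⟨m, rfl⟩ := Nat.exists_eq_succ_of_ne_zero hk
  have : (2 : ℝ) ^ (2 * (m + 1)) = 2 * 2 ^ (2 * (m + 1) - 1) := by
    rw [← pow_succ']; congr 1
  rw [this]
  field_simp

theorem zeta_even_pos {k : ℕ} (hk : k ≠ 0) :
    0 < (-1 : ℝ) ^ (k + 1) * ((2 * π) ^ (2 * k) / 2 / (2 * k).factorial) * bernoulli (2 * k) := by
  have h := hasSum_zeta_even hk
  have := le_hasSum h 1 (fun n _ => by positivity)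
  simp only [Nat.cast_one, one_pow, div_one] at this
  linarith

theorem bernoulli_even_pos {k : ℕ} (hk : k ≠ 0) :
    0 < (-1 : ℝ) ^ (k + 1) * bernoulli (2 * k) := by
  have h := zeta_even_pos hk
  have hc : 0 < (2 * π) ^ (2 * k) / 2 / (2 * k).factorial := by positivity
  rw [mul_right_comm] at h
  exact pos_of_mul_pos_left h hc.le

theorem abs_bernoulli_even {k : ℕ} (hk : k ≠ 0) :
    |(bernoulli (2 * k) : ℝ)| = (-1 : ℝ) ^ (k + 1) * bernoulli (2 * k) := by
  rw [← abs_of_pos (bernoulli_even_pos hk), abs_mul, abs_pow, abs_neg, abs_one, one_pow, one_mul]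

theorem bernoulli_even_ne_zero {k : ℕ} (hk : k ≠ 0) : (bernoulli (2 * k) : ℝ) ≠ 0 := by
  intro h
  simpa [h] using bernoulli_even_pos hk

/-- Up to a constant factor, the Fourier series is ∑ cos(2πnx)/n^{2k}, which is dominated termwise
by its value at x = 0. -/
theorem abs_bernoulliFun_even_le {k : ℕ} (hk : k ≠ 0) {x : ℝ} (hx : x ∈ Icc (0 : ℝ) 1) :
    |bernoulliFun (2 * k) x| ≤ |(bernoulli (2 * k) : ℝ)| := by
  have h1 := hasSum_one_div_nat_pow_mul_cos hk hx
  have h2 := hasSum_zeta_even hk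
  have hc : 0 < (2 * π) ^ (2 * k) / 2 / (2 * k).factorial := by positivity
  have e : (-1 : ℝ) ^ (k + 1) * (2 * π) ^ (2 * k) / 2 / (2 * k).factorial =
      (-1) ^ (k + 1) * ((2 * π) ^ (2 * k) / 2 / (2 * k).factorial) := by ring
  have h3 := h1.norm_le_of_bounded h2 (fun n => by
    rw [norm_mul, norm_of_nonneg (by positivity : (0 : ℝ) ≤ 1 / (n : ℝ) ^ (2 * k))]
    exact mul_le_of_le_one_right (by positivity) (abs_cos_le_one _))
  rw [abs_bernoulli_even hk]
  change ‖_ * bernoulliFun (2 * k) x‖ ≤ _ at h3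
  rw [e, norm_mul, norm_mul, norm_pow, norm_neg, norm_one, one_pow, one_mul, norm_of_nonneg hc.le,
    mul_right_comm, mul_comm] at h3
  exact le_of_mul_le_mul_right h3 hc

/-- This is ζ(2k+2) ≤ ζ(2k), compared term by term; the term n = 0 is 1/0 = 0 on both sides. -/
theorem abs_bernoulli_even_succ_le {k : ℕ} (hk : k ≠ 0) :
    (2 * π) ^ 2 * |(bernoulli (2 * (k + 1)) : ℝ)| ≤
      (2 * k + 2) * (2 * k + 1) * |(bernoulli (2 * k) : ℝ)| := by
  have h := hasSum_le (fun n : ℕ => ?_) (hasSum_zeta_even k.succ_ne_zero) (hasSum_zeta_even hk)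
  · rw [mul_right_comm, Nat.succ_eq_add_one, ← abs_bernoulli_even k.succ_ne_zero, mul_right_comm,
      ← abs_bernoulli_even hk] at h
    have e : (2 * (k + 1)).factorial = (2 * k + 2) * ((2 * k + 1) * (2 * k).factorial) := rfl
    rw [e, mul_add 2 k 1, pow_add] at h
    push_cast at h
    have hf : (0 : ℝ) < (2 * k).factorial := by positivity
    have hp : 0 < (2 * π) ^ (2 * k) := by positivity
    rw [mul_add 2 k 1]
    set F : ℝ := ((2 * k).factorial : ℝ)
    set p := (2 * π) ^ (2 * k)
    set b := |(bernoulli (2 * k) : ℝ)|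
    set b' := |(bernoulli (2 * k + 2 * 1) : ℝ)|
    have e1 : b' * (p * (2 * π) ^ 2 / 2 / ((2 * k + 2) * ((2 * k + 1) * F))) =
      ((2 * π) ^ 2 * b') * (p / 2 / F / ((2 * k + 2) * (2 * k + 1))) := by field_simp
    have e2 : b * (p / 2 / F) =
      ((2 * k + 2) * (2 * k + 1) * b) * (p / 2 / F / ((2 * k + 2) * (2 * k + 1))) := by field_simp
    rw [e1, e2] at h
    exact le_of_mul_le_mul_right h (by positivity)
  · rcases Nat.eq_zero_or_pos n with rfl | hn
    · simp [hk]
    · have : (1 : ℝ) ≤ n := by exact_mod_cast hn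
      exact one_div_le_one_div_of_le (by positivity) (pow_le_pow_right₀ this (by simp))

/-! ### The Gamma quotient and the integral of (u² + t²)^{-j}. -/

/-- The ratio `√π Γ(j + 1/2) / Γ(j)`. -/
noncomputable def gammaRatio (j : ℕ) : ℝ := √π * Gamma (j + 1 / 2) / Gamma j

theorem gammaRatio_one : gammaRatio 1 = π / 2 := by
  have : Gamma (((1 : ℕ) : ℝ) + 1 / 2) = 1 / 2 * √π := by
    rw [Nat.cast_one, add_comm, Real.Gamma_add_one (by norm_num), Real.Gamma_one_half_eq]
  rw [gammaRatio, this, Nat.cast_one, Real.Gamma_one]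
  have := Real.mul_self_sqrt pi_pos.le
  linarith

theorem gammaRatio_succ {j : ℕ} (hj : j ≠ 0) :
    gammaRatio (j + 1) = gammaRatio j * ((j + 1 / 2) / j) := by
  have hj' : (0 : ℝ) < j := by positivity
  have e : ((j + 1 : ℕ) : ℝ) + 1 / 2 = ((j : ℝ) + 1 / 2) + 1 := by push_cast; ring
  rw [gammaRatio, e, Real.Gamma_add_one (by positivity), Nat.cast_add_one,
    Real.Gamma_add_one hj'.ne', gammaRatio]
  have := Real.Gamma_pos_of_pos hj'
  field_simp

theorem gammaRatio_pos {j : ℕ} (hj : j ≠ 0) : 0 < gammaRatio j := by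
  have hj' : (0 : ℝ) < j := by positivity
  have := Real.Gamma_pos_of_pos hj'
  have := Real.Gamma_pos_of_pos (by positivity : (0 : ℝ) < j + 1 / 2)
  unfold gammaRatio
  positivity

/-- Log-convexity at the midpoint of j and j + 1: Γ(j + 1/2)² ≤ Γ(j) Γ(j + 1) = j Γ(j)². -/
theorem gammaRatio_sq_le {j : ℕ} (hj : j ≠ 0) : gammaRatio j ^ 2 ≤ π * j := by
  have hj' : (0 : ℝ) < j := by positivity
  have hg := Real.Gamma_pos_of_pos hj'
  have h := Real.Gamma_mul_add_mul_le_rpow_Gamma_mul_rpow_Gamma hj' (by positivity : (0 : ℝ) < j + 1)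
    (by norm_num : (0 : ℝ) < 1 / 2) (by norm_num : (0 : ℝ) < 1 / 2) (by norm_num)
  rw [show (1 / 2 : ℝ) * j + 1 / 2 * (j + 1) = j + 1 / 2 by ring, ← Real.sqrt_eq_rpow,
    ← Real.sqrt_eq_rpow, Real.Gamma_add_one hj'.ne'] at h
  have h0 := Real.Gamma_pos_of_pos (by positivity : (0 : ℝ) < j + 1 / 2)
  have h2 := pow_le_pow_left₀ h0.le h 2
  rw [mul_pow, Real.sq_sqrt hg.le, Real.sq_sqrt (by positivity)] at h2
  rw [gammaRatio, div_pow, mul_pow, Real.sq_sqrt pi_pos.le, div_le_iff₀ (by positivity)]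
  nlinarith [pi_pos]

/-- Strictness comes from using the weak bound at j + 1 and stepping back by the recurrence, since
j(j + 1) < (j + 1/2)². -/
theorem gammaRatio_lt_sqrt {j : ℕ} (hj : j ≠ 0) : gammaRatio j < √(π * j) := by
  have hj' : (0 : ℝ) < j := by positivity
  apply Real.lt_sqrt_of_sq_lt
  have h := gammaRatio_sq_le (j := j + 1) (by simp)
  rw [gammaRatio_succ hj, mul_pow, div_pow, mul_div_assoc', div_le_iff₀ (by positivity)] at h
  push_cast at h
  have h3 : gammaRatio j ^ 2 * (j * (j + 1)) < gammaRatio j ^ 2 * (j + 1 / 2) ^ 2 :=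
    mul_lt_mul_of_pos_left (by nlinarith) (pow_pos (gammaRatio_pos hj) 2)
  have h4 : gammaRatio j ^ 2 * (j * (j + 1)) < π * j * (j * (j + 1)) := by nlinarith
  exact lt_of_mul_lt_mul_right h4 (by positivity)

theorem integrableOn_inv_sq_add_sq_pow {t : ℝ} (ht : 0 < t) {j : ℕ} (hj : j ≠ 0) :
    IntegrableOn (fun u : ℝ => ((u ^ 2 + t ^ 2) ^ j)⁻¹) (Ioi 0) := by
  have h1 : Integrable (fun u : ℝ => (t ^ (2 * j))⁻¹ * (1 + (u / t) ^ 2)⁻¹) :=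
    (integrable_inv_one_add_sq.comp_div ht.ne').const_mul _
  refine (h1.mono' (Continuous.aestronglyMeasurable ?_) (ae_of_all _ fun u => ?_)).integrableOn
  · exact Continuous.inv₀ (by fun_prop) (fun u => by positivity)
  · rw [norm_of_nonneg (by positivity), ← mul_inv]
    refine inv_anti₀ (by positivity) ?_
    have : u ^ 2 + t ^ 2 = t ^ 2 * (1 + (u / t) ^ 2) := by field_simp; ring
    rw [this, mul_pow, ← pow_mul]
    exact mul_le_mul_of_nonneg_left
      (le_self_pow₀ (by nlinarith [sq_nonneg (u / t)]) hj) (by positivity)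

/-- Integrating the derivative of u (u² + t²)^{-n} over the half line gives I_{n+1} = (2n - 1)/(2n
t²) · I_n, the same recurrence as `gammaRatio_succ`; I₁ is an arctangent. -/
theorem integral_inv_sq_add_sq_pow {t : ℝ} (ht : 0 < t) {j : ℕ} (hj : j ≠ 0) :
    (2 * j - 1) * t ^ (2 * j - 1) * ∫ u in Ioi (0 : ℝ), ((u ^ 2 + t ^ 2) ^ j)⁻¹ = gammaRatio j := by
  induction j with
  | zero => exact absurd rfl hj
  | succ n ih =>
    rcases Nat.eq_zero_or_pos n with rfl | hn
    · rw [zero_add, gammaRatio_one]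
      have h := integral_comp_mul_left_Ioi (fun u : ℝ => (1 + u ^ 2)⁻¹) 0 (inv_pos.2 ht)
      rw [mul_zero, integral_Ioi_inv_one_add_sq, arctan_zero] at h
      have e : ∀ u : ℝ, (1 + (t⁻¹ * u) ^ 2)⁻¹ = t ^ 2 * ((u ^ 2 + t ^ 2) ^ 1)⁻¹ := by
        intro u
        have : u ^ 2 + t ^ 2 ≠ 0 := by positivity
        rw [inv_mul_eq_div, pow_one]
        field_simp
        ring
      simp_rw [e, integral_const_mul] at h
      simp only [inv_inv, smul_eq_mul, sub_zero] at h
      have := mul_left_cancel₀ ht.ne' (show t * (t * ∫ u in Ioi (0 : ℝ), ((u ^ 2 + t ^ 2) ^ 1)⁻¹)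
        = t * (π / 2) by rw [← h]; ring)
      rw [← this]
      norm_num
    · have hn' : n ≠ 0 := hn.ne'
      have hd : ∀ u : ℝ, HasDerivAt (fun u : ℝ => u * ((u ^ 2 + t ^ 2) ^ n)⁻¹)
          ((1 - 2 * n) * ((u ^ 2 + t ^ 2) ^ n)⁻¹ +
            2 * n * t ^ 2 * ((u ^ 2 + t ^ 2) ^ (n + 1))⁻¹) u := by
        intro u
        have h1 : HasDerivAt (fun u : ℝ => u ^ 2 + t ^ 2) (2 * u) u := by
          simpa using (hasDerivAt_pow 2 u).add_const (t ^ 2)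
        have hp : u ^ 2 + t ^ 2 ≠ 0 := by positivity
        refine ((hasDerivAt_id u).mul ((h1.pow n).inv (pow_ne_zero _ hp))).congr_deriv ?_
        obtain ⟨m, rfl⟩ := Nat.exists_eq_succ_of_ne_zero hn'
        simp only [Nat.succ_eq_add_one, Nat.add_sub_cancel, id, Pi.inv_apply, Pi.pow_apply]
        push_cast
        field_simp
        ring
      have hI := integrableOn_inv_sq_add_sq_pow ht hn'
      have hI' := integrableOn_inv_sq_add_sq_pow ht n.succ_ne_zero
      have hlim : Tendsto (fun u : ℝ => u * ((u ^ 2 + t ^ 2) ^ n)⁻¹) atTop (𝓝 0) := by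
        have hc : Tendsto (fun u : ℝ => (t ^ (2 * (n - 1)))⁻¹ * u⁻¹) atTop (𝓝 0) := by
          simpa using tendsto_inv_atTop_zero.const_mul ((t ^ (2 * (n - 1)))⁻¹)
        refine squeeze_zero' ?_ ?_ hc
        · filter_upwards [eventually_gt_atTop 0] with u hu
          positivity
        · filter_upwards [eventually_gt_atTop 0] with u hu
          obtain ⟨m, rfl⟩ := Nat.exists_eq_succ_of_ne_zero hn'
          rw [← div_eq_mul_inv, div_le_iff₀ (by positivity), ← mul_inv, inv_mul_eq_div,
            le_div_iff₀ (by positivity), Nat.succ_sub_one, pow_succ, pow_mul]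
          have h1 : (t ^ 2) ^ m ≤ (u ^ 2 + t ^ 2) ^ m :=
            pow_le_pow_left₀ (by positivity) (by nlinarith) _
          have h2 : u * u ≤ u ^ 2 + t ^ 2 := by nlinarith
          have := mul_le_mul h1 h2 (by positivity) (by positivity)
          linarith
      have h := integral_Ioi_of_hasDerivAt_of_tendsto' (a := 0) (fun u _ => hd u)
        ((hI.const_mul _).add (hI'.const_mul _)) hlim
      rw [integral_add (hI.const_mul _) (hI'.const_mul _), integral_const_mul,
        integral_const_mul, zero_mul, sub_zero] at h
      rw [gammaRatio_succ hn', ← ih hn']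
      obtain ⟨m, rfl⟩ := Nat.exists_eq_succ_of_ne_zero hn'
      have e1 : 2 * (m.succ + 1) - 1 = (2 * m.succ - 1) + 2 := by omega
      rw [e1, pow_add]
      have hx : (0 : ℝ) < m.succ := by positivity
      have hB : ∫ u in Ioi (0 : ℝ), ((u ^ 2 + t ^ 2) ^ (m.succ + 1))⁻¹ =
          (2 * m.succ - 1) * (∫ u in Ioi (0 : ℝ), ((u ^ 2 + t ^ 2) ^ m.succ)⁻¹) /
            (2 * m.succ * t ^ 2) := by
        rw [eq_div_iff (by positivity)]
        linarith
      rw [hB, Nat.cast_add_one]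
      field_simp
      ring

/-! ### The recurrence inequality and its numerical solution. -/

theorem pi_sq_gt : 9.869 < π ^ 2 := by nlinarith [pi_gt_d4]

theorem pi_sq_lt : π ^ 2 < 9.8697 := by nlinarith [pi_lt_d4, pi_pos]

/-- A rational upper bound for `gammaRatio (n + 1)`. -/
def gammaRatioBound : ℕ → ℚ
  | 0 => 15708 / 10000
  | n + 1 => gammaRatioBound n * ((n + 3 / 2) / (n + 1))

theorem gammaRatio_le_bound (n : ℕ) : gammaRatio (n + 1) ≤ gammaRatioBound n := by
  induction n with
  | zero =>
    rw [gammaRatio_one, gammaRatioBound]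
    have := pi_lt_d4
    norm_num
    linarith
  | succ n ih =>
    rw [gammaRatio_succ n.succ_ne_zero, gammaRatioBound]
    push_cast
    have e : (n : ℝ) + 1 + 1 / 2 = n + 3 / 2 := by ring
    rw [e]
    exact mul_le_mul_of_nonneg_right ih (by positivity)

/-- The bound obtained by applying `n` times the recurrence `a_j ≤ j (j - 1/2) (1 + a_{j+1}) / (π k)²`
to `a_j`, and then bounding by `gammaRatio`. -/
def iteratedBound (k : ℕ) : ℕ → ℕ → ℚ
  | 0, j => gammaRatioBound (j - 1)
  | n + 1, j => j * (j - 1 / 2) / (9869 / 1000 * k ^ 2) * (1 + iteratedBound k n (j + 1))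

section

variable {k : ℕ} {a : ℕ → ℝ}

theorem le_iteratedBound (hk : 1 ≤ k) (h0 : ∀ j, 1 ≤ j → 0 ≤ a j)
    (hrec : ∀ j : ℕ, 1 ≤ j → a j ≤ j * (j - 1 / 2) / (π * k) ^ 2 * (1 + a (j + 1)))
    (hs : ∀ j, 1 ≤ j → a j ≤ gammaRatio j) (n : ℕ) :
    ∀ j : ℕ, 1 ≤ j → a j ≤ iteratedBound k n j := by
  have hk' : (1 : ℝ) ≤ k := by exact_mod_cast hk
  induction n with
  | zero =>
    intro j hj
    obtain ⟨m, rfl⟩ := Nat.exists_eq_add_of_le' hj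
    exact (hs _ hj).trans (gammaRatio_le_bound m)
  | succ n ih =>
    intro j hj
    have hj' : (1 : ℝ) ≤ j := by exact_mod_cast hj
    refine (hrec j hj).trans ?_
    rw [iteratedBound]
    push_cast
    have h1 := ih (j + 1) (by omega)
    have h2 := h0 (j + 1) (by omega)
    refine mul_le_mul ?_ (by linarith) (by linarith) ?_
    · refine div_le_div_of_nonneg_left (by nlinarith) (by positivity) ?_
      rw [mul_pow]
      refine mul_le_mul_of_nonneg_right ?_ (by positivity)
      have := pi_sq_gt
      norm_num at this ⊢
      exact this.le
    · exact div_nonneg (by nlinarith) (by positivity)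

/-- Starting at k + 1, the 2k - 1 steps end at index 3k. Since 3 < π, every factor j(j - 1/2)/(πk)²
on the way is below 1, so the crude starting bound is damped. -/
theorem iteratedBound_lt (hk : 1 ≤ k) (hk7 : k ≤ 7) :
    (1 - 1 / (2 * (k : ℚ))) * (1 + iteratedBound k (2 * k - 1) (k + 1)) < 98697 / 88697 := by
  interval_cases k <;> norm_num [iteratedBound, gammaRatioBound]

/-- The left side is x/(x - 1), a decreasing function, at x = 9.8697 > π². -/
theorem quotient_lt : (98697 / 88697 : ℝ) < π ^ 2 / (π ^ 2 - 1) := by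
  have h1 := pi_sq_gt
  have h2 := pi_sq_lt
  rw [div_lt_div_iff₀ (by norm_num) (by linarith)]
  norm_num at h2
  linarith

theorem mul_one_add_lt_of_le_seven (hk : 1 ≤ k) (hk7 : k ≤ 7) (h0 : ∀ j, 1 ≤ j → 0 ≤ a j)
    (hrec : ∀ j : ℕ, 1 ≤ j → a j ≤ j * (j - 1 / 2) / (π * k) ^ 2 * (1 + a (j + 1)))
    (hs : ∀ j, 1 ≤ j → a j ≤ gammaRatio j) :
    (1 - 1 / (2 * (k : ℝ))) * (1 + a (k + 1)) < π ^ 2 / (π ^ 2 - 1) := by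
  have h1 := le_iteratedBound hk h0 hrec hs (2 * k - 1) (k + 1) (by omega)
  have h2 : (1 - 1 / (2 * (k : ℝ))) * (1 + iteratedBound k (2 * k - 1) (k + 1)) < 98697 / 88697 := by
    have h := (Rat.cast_lt (K := ℝ)).2 (iteratedBound_lt hk hk7)
    push_cast at h
    exact h
  have hk' : (1 : ℝ) ≤ k := by exact_mod_cast hk
  have h3 : 1 / (2 * (k : ℝ)) ≤ 1 := by
    rw [div_le_one (by positivity)]
    linarith
  exact ((mul_le_mul_of_nonneg_left (by linarith) (by linarith)).trans_lt h2).trans quotient_lt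

/-- One step of the descent: the profile `j² / (π²k² - c j²)` with `c = 1 + 1/k` is a supersolution
of the recurrence. -/
theorem profile_step {j : ℕ} (hk : 8 ≤ k) (hj : k + 1 ≤ j) (hj2 : j + 1 ≤ 2 * k) :
    (j * (j - 1 / 2) / (π * k) ^ 2 : ℝ) * ((π * k) ^ 2 /
      ((π * k) ^ 2 - (1 + 1 / k) * ((j : ℝ) + 1) ^ 2)) ≤
      (1 + 1 / k) * (j : ℝ) ^ 2 / ((π * k) ^ 2 - (1 + 1 / k) * (j : ℝ) ^ 2) := by
  have hk' : (8 : ℝ) ≤ k := by exact_mod_cast hk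
  have hj' : (k : ℝ) + 1 ≤ j := by exact_mod_cast hj
  have hj2' : (j : ℝ) + 1 ≤ 2 * k := by exact_mod_cast hj2
  have hpi := pi_sq_gt
  have hk0 : (0 : ℝ) < k := by linarith
  obtain ⟨c, hc⟩ : ∃ c : ℝ, c = 1 + 1 / k := ⟨_, rfl⟩
  obtain ⟨y, hy⟩ : ∃ y : ℝ, y = j / k := ⟨_, rfl⟩
  have hck : c * k = k + 1 := by rw [hc]; field_simp
  have hyk : (j : ℝ) = y * k := by rw [hy]; field_simp
  have hc1 : 1 < c := by rw [hc]; linarith [one_div_pos.2 hk0]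
  have hc2 : c ≤ 9 / 8 := by
    rw [hc]
    have : 1 / (k : ℝ) ≤ 1 / 8 := one_div_le_one_div_of_le (by norm_num) hk'
    linarith
  have hy1 : 1 < y := by rw [hy, one_lt_div hk0]; linarith
  have hy2 : y ≤ 2 := by rw [hy, div_le_iff₀ hk0]; linarith
  have hden2 : 0 < (π * k) ^ 2 - (1 + 1 / k) * ((j : ℝ) + 1) ^ 2 := by
    rw [← hc, mul_pow]
    have : ((j : ℝ) + 1) ^ 2 ≤ 4 * k ^ 2 := by nlinarith
    nlinarith [sq_nonneg (k : ℝ)]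
  have hden1 : 0 < (π * k) ^ 2 - (1 + 1 / k) * (j : ℝ) ^ 2 := by
    rw [← hc] at hden2 ⊢
    nlinarith
  have hq : 0 < (π * k) ^ 2 := by positivity
  rw [div_mul_div_comm, mul_comm ((π * (k : ℝ)) ^ 2) (_ - _), mul_div_mul_right _ _ hq.ne',
    div_le_div_iff₀ hden2 hden1, ← hc]
  have key : ((j : ℝ) - 1 / 2) * ((π * k) ^ 2 - c * j ^ 2) ≤
      c * j * ((π * k) ^ 2 - c * ((j : ℝ) + 1) ^ 2) := by
    -- With j = yk, 1 < y ≤ 2, the claim divided by k² is `main`; bounding the bracket by 10 and c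
    -- by 9/8 reduces it to 11.25 y ≤ π²(y + 1/2).
    have hb : y ^ 2 * 1 + (2 * c + 1 / 2) * y + c / k ≤ 10 := by
      have : c / k ≤ 1 := by rw [div_le_one hk0]; linarith
      nlinarith
    have hck2 : c / k * k = c := by field_simp
    have main : 0 ≤ π ^ 2 * (y + 1 / 2) - c * y * (y ^ 2 * 1 + (2 * c + 1 / 2) * y + c / k) := by
      have : c * y * (y ^ 2 * 1 + (2 * c + 1 / 2) * y + c / k) ≤ 9 / 8 * y * 10 := by gcongr
      nlinarith
    have e : c * j * ((π * k) ^ 2 - c * ((j : ℝ) + 1) ^ 2) -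
        ((j : ℝ) - 1 / 2) * ((π * k) ^ 2 - c * j ^ 2) =
        k ^ 2 * (π ^ 2 * (y + 1 / 2) - c * y * (y ^ 2 * 1 + (2 * c + 1 / 2) * y + c / k)) := by
      rw [hyk, hc]
      field_simp
      ring
    nlinarith [mul_nonneg (sq_nonneg (k : ℝ)) main]
  have hj0 : (0 : ℝ) ≤ j := by linarith
  nlinarith [mul_le_mul_of_nonneg_left key hj0]

/-- Descent from j = 2k to k + 1. The profile absorbs the inhomogeneous part of the recurrence, and
the initial excess, at most `gammaRatio (2 * k)`, shrinks at each step by a factor at most 4/π² <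
0.4054. -/
theorem le_profile (hk : 8 ≤ k)
    (hrec : ∀ j : ℕ, 1 ≤ j → a j ≤ j * (j - 1 / 2) / (π * k) ^ 2 * (1 + a (j + 1)))
    (hs : ∀ j, 1 ≤ j → a j ≤ gammaRatio j) {n : ℕ} (hn : n + 1 ≤ k) :
    a (2 * k - n) ≤ (1 + 1 / k) * ((2 * k - n : ℕ) : ℝ) ^ 2 /
      ((π * k) ^ 2 - (1 + 1 / k) * ((2 * k - n : ℕ) : ℝ) ^ 2) + gammaRatio (2 * k) * 0.4054 ^ n := by
  have hk' : (8 : ℝ) ≤ k := by exact_mod_cast hk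
  have hpi := pi_sq_gt
  have hc2 : 1 + 1 / (k : ℝ) ≤ 9 / 8 := by
    have : 1 / (k : ℝ) ≤ 1 / 8 := one_div_le_one_div_of_le (by norm_num) hk'
    linarith
  have hden : ∀ j : ℕ, j ≤ 2 * k → 0 < (π * k) ^ 2 - (1 + 1 / k) * (j : ℝ) ^ 2 := by
    intro j hj
    have hj' : (j : ℝ) ≤ 2 * k := by exact_mod_cast hj
    have : (j : ℝ) ^ 2 ≤ 4 * k ^ 2 := by nlinarith [(Nat.cast_nonneg j : (0 : ℝ) ≤ j)]
    have h3 : (1 + 1 / (k : ℝ)) * (j : ℝ) ^ 2 ≤ 9 / 8 * (4 * k ^ 2) := by gcongr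
    rw [mul_pow]
    nlinarith
  induction n with
  | zero =>
    rw [pow_zero, mul_one, Nat.sub_zero]
    have h1 := hs (2 * k) (by omega)
    have h2 : 0 ≤ (1 + 1 / k) * ((2 * k : ℕ) : ℝ) ^ 2 /
        ((π * k) ^ 2 - (1 + 1 / k) * ((2 * k : ℕ) : ℝ) ^ 2) :=
      div_nonneg (by positivity) (hden _ le_rfl).le
    linarith
  | succ n ih =>
    have ih := ih (by omega)
    obtain ⟨j, hj⟩ : ∃ j, j = 2 * k - (n + 1) := ⟨_, rfl⟩
    have hj1 : 2 * k - n = j + 1 := by omega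
    rw [hj1] at ih
    rw [← hj]
    have hstep := profile_step hk (by omega : k + 1 ≤ j) (by omega)
    have hd := hden (j + 1) (by omega)
    have hjk : (k : ℝ) + 1 ≤ j := by exact_mod_cast (by omega : k + 1 ≤ j)
    have hj2k : (j : ℝ) ≤ 2 * k := by exact_mod_cast (by omega : j ≤ 2 * k)
    have hrho0 : (0 : ℝ) ≤ j * (j - 1 / 2) / (π * k) ^ 2 :=
      div_nonneg (mul_nonneg (by linarith) (by linarith)) (by positivity)
    have hrho : (j * (j - 1 / 2) / (π * k) ^ 2 : ℝ) ≤ 0.4054 := by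
      rw [div_le_iff₀ (by positivity), mul_pow]
      have h1 : (j : ℝ) * (j - 1 / 2) ≤ 4 * k ^ 2 := by nlinarith
      have h2 : (9.869 : ℝ) * k ^ 2 ≤ π ^ 2 * k ^ 2 := by gcongr
      norm_num at h2 ⊢
      nlinarith [sq_nonneg (k : ℝ)]
    have hg := (gammaRatio_pos (by omega : 2 * k ≠ 0)).le
    have h1 := hrec j (by omega)
    push_cast at ih hd
    have h2 : 1 + (1 + 1 / k) * ((j : ℝ) + 1) ^ 2 / ((π * k) ^ 2 - (1 + 1 / k) * ((j : ℝ) + 1) ^ 2)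
        = (π * k) ^ 2 / ((π * k) ^ 2 - (1 + 1 / k) * ((j : ℝ) + 1) ^ 2) := by
      rw [eq_div_iff hd.ne', add_mul, div_mul_cancel₀ _ hd.ne']
      ring
    have h3 := mul_le_mul_of_nonneg_left ih hrho0
    have h4 := mul_le_mul_of_nonneg_right hrho
      (by positivity : (0 : ℝ) ≤ gammaRatio (2 * k) * 0.4054 ^ n)
    rw [← h2] at hstep
    rw [pow_succ (0.4054 : ℝ)]
    linarith

theorem geometric_tail_le (hk : 8 ≤ k) : (k : ℝ) ^ 2 * 0.4054 ^ (k - 1) ≤ 0.12 := by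
  induction k, hk using Nat.le_induction with
  | base => norm_num
  | succ n hn ih =>
    have hn' : (8 : ℝ) ≤ n := by exact_mod_cast hn
    obtain ⟨m, rfl⟩ := Nat.exists_eq_add_of_le' (by omega : 1 ≤ n)
    simp only [Nat.add_sub_cancel] at ih ⊢
    have hp : (0 : ℝ) ≤ 0.4054 ^ m := by positivity
    rw [pow_succ (0.4054 : ℝ)]
    have : (((m + 1 + 1 : ℕ) : ℝ)) ^ 2 * 0.4054 ≤ ((m + 1 : ℕ) : ℝ) ^ 2 := by
      push_cast at hn' ⊢
      nlinarith
    nlinarith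

theorem mul_one_add_lt_of_eight_le (hk : 8 ≤ k)
    (hrec : ∀ j : ℕ, 1 ≤ j → a j ≤ j * (j - 1 / 2) / (π * k) ^ 2 * (1 + a (j + 1)))
    (hs : ∀ j, 1 ≤ j → a j ≤ gammaRatio j) :
    (1 - 1 / (2 * (k : ℝ))) * (1 + a (k + 1)) < π ^ 2 / (π ^ 2 - 1) := by
  have hk' : (8 : ℝ) ≤ k := by exact_mod_cast hk
  have hk0 : (0 : ℝ) < k := by linarith
  have h1 := le_profile hk hrec hs (n := k - 1) (by omega)
  rw [show 2 * k - (k - 1) = k + 1 by omega] at h1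
  -- √(2πk) ≤ k because 2π < 8 ≤ k.
  have hg : gammaRatio (2 * k) ≤ k := by
    refine (gammaRatio_lt_sqrt (by omega)).le.trans (Real.sqrt_le_iff.2 ⟨hk0.le, ?_⟩)
    push_cast
    nlinarith [pi_lt_d4]
  have htail : gammaRatio (2 * k) * 0.4054 ^ (k - 1) ≤ 0.12 / k := by
    rw [le_div_iff₀ hk0]
    have := geometric_tail_le hk
    have h2 := mul_le_mul_of_nonneg_right hg (by positivity : (0 : ℝ) ≤ 0.4054 ^ (k - 1))
    nlinarith
  obtain ⟨x, hx⟩ : ∃ x : ℝ, x = 1 / k := ⟨_, rfl⟩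
  have hxk : x * k = 1 := by rw [hx]; field_simp
  have hx0 : 0 < x := by rw [hx]; positivity
  have hx8 : x ≤ 1 / 8 := by rw [hx]; exact one_div_le_one_div_of_le (by norm_num) hk'
  have hp1 := pi_sq_gt
  have hp2 := pi_sq_lt
  set P := π ^ 2 with hP
  have hden : 0 < P - (1 + x) ^ 3 := by nlinarith [pow_le_pow_left₀ (by linarith) (by linarith : 1 + x ≤ 9 / 8) 3]
  have e1 : 1 + (1 + 1 / k) * ((k + 1 : ℕ) : ℝ) ^ 2 /
      ((π * k) ^ 2 - (1 + 1 / k) * ((k + 1 : ℕ) : ℝ) ^ 2) = P / (P - (1 + x) ^ 3) := by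
    have e2 : ((k + 1 : ℕ) : ℝ) = k * (1 + x) := by push_cast; linarith
    have e3 : (π * k) ^ 2 - (1 + x) * (k * (1 + x)) ^ 2 = k ^ 2 * (P - (1 + x) ^ 3) := by
      rw [hP]; ring
    rw [← hx, e2, e3]
    field_simp
    ring
  have e4 : 1 / (2 * (k : ℝ)) = x / 2 := by rw [hx]; field_simp
  have e5 : (0.12 : ℝ) / k = 0.12 * x := by rw [hx]; field_simp
  rw [e4]
  rw [e5] at htail
  have h3 : 1 + a (k + 1) ≤ P / (P - (1 + x) ^ 3) + 0.12 * x := by linarith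
  refine (mul_le_mul_of_nonneg_left h3 (by linarith)).trans_lt ?_
  have h4 : (1 - x / 2) * (0.12 * x) ≤ 0.12 * x := by nlinarith
  suffices h : (1 - x / 2) * (P / (P - (1 + x) ^ 3)) + 0.12 * x < P / (P - 1) by linarith
  rw [mul_div_assoc', div_add' _ _ _ hden.ne', div_lt_div_iff₀ hden (by linarith)]
  -- After cross-multiplication, x times this right side is the gain from the factor 1 - x/2. It
  -- must beat the tail 0.12 x (P - 1)(P - (1 + x)³) ≤ 9.6 x, and 10 > 9.6.
  have h5 : 10 ≤ P * ((P - 1) / 2 - 3 - 3 * x - x ^ 2) := by nlinarith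
  have h6 : (P - 1) * (P - (1 + x) ^ 3) ≤ 80 := by
    have : 1 ≤ (1 + x) ^ 3 := one_le_pow₀ (by linarith)
    nlinarith
  nlinarith [mul_le_mul_of_nonneg_left h5 hx0.le, mul_le_mul_of_nonneg_left h6 hx0.le]

theorem lt_of_recurrence (hk : 1 ≤ k) {t : ℝ} (ht : (k : ℝ) ≤ t) (h0 : ∀ j, 1 ≤ j → 0 ≤ a j)
    (hrec : ∀ j : ℕ, 1 ≤ j → a j ≤ j * (j - 1 / 2) / (π * t) ^ 2 * (1 + a (j + 1)))
    (hs : ∀ j, 1 ≤ j → a j ≤ gammaRatio j) : a k < (k / t) ^ 2 / (π ^ 2 - 1) := by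
  have hk' : (1 : ℝ) ≤ k := by exact_mod_cast hk
  have ht0 : 0 < t := by linarith
  -- Replacing t by k makes the bound on a_{k+1} independent of t; the original recurrence is kept
  -- for the last step, which supplies (k/t)².
  have hrec' : ∀ j : ℕ, 1 ≤ j → a j ≤ j * (j - 1 / 2) / (π * k) ^ 2 * (1 + a (j + 1)) := by
    intro j hj
    have hj' : (1 : ℝ) ≤ j := by exact_mod_cast hj
    have h1 := h0 (j + 1) (by omega)
    refine (hrec j hj).trans (mul_le_mul_of_nonneg_right ?_ (by linarith))
    exact div_le_div_of_nonneg_left (by nlinarith) (by positivity) (by gcongr)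
  have key : (1 - 1 / (2 * (k : ℝ))) * (1 + a (k + 1)) < π ^ 2 / (π ^ 2 - 1) := by
    rcases le_or_gt k 7 with h | h
    · exact mul_one_add_lt_of_le_seven hk h h0 hrec' hs
    · exact mul_one_add_lt_of_eight_le h hrec' hs
  refine (hrec k hk).trans_lt ?_
  have e1 : (k * (k - 1 / 2) / (π * t) ^ 2 : ℝ) * (1 + a (k + 1)) =
      (k / t) ^ 2 / π ^ 2 * ((1 - 1 / (2 * (k : ℝ))) * (1 + a (k + 1))) := by
    field_simp
  have e2 : (k / t) ^ 2 / (π ^ 2 - 1) = (k / t) ^ 2 / π ^ 2 * (π ^ 2 / (π ^ 2 - 1)) := by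
    field_simp
  rw [e1, e2]
  exact mul_lt_mul_of_pos_left key (by positivity)

end

/-! ### From identities of exponentials to identities of logarithms. -/

/-- The values lie in the discrete set 2πiℤ, so f is constant on S, and one real value forces that
constant to be 0. This fixes the branch in every logarithmic identity below. -/
theorem eq_zero_of_exp_eq_one {X : Type*} [TopologicalSpace X] {S : Set X} (hS : IsPreconnected S)
    {f : X → ℂ} (hf : ContinuousOn f S) (hexp : ∀ z ∈ S, Complex.exp (f z) = 1) {z₀ : X}
    (h₀ : z₀ ∈ S) (him : (f z₀).im = 0) {z : X} (hz : z ∈ S) : f z = 0 := by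
  have hd : DiscreteTopology (range ((↑) : ℤ → ℝ)) :=
    Int.isClosedEmbedding_coe_real.isEmbedding.toHomeomorph.symm.isEmbedding.discreteTopology
  have hval : ∀ w ∈ S, ∃ n : ℤ, f w = n * (2 * π * Complex.I) := fun w hw =>
    Complex.exp_eq_one_iff.1 (hexp w hw)
  have him' : ∀ w (n : ℤ), f w = n * (2 * π * Complex.I) → (f w).im / (2 * π) = n := by
    intro w n h
    rw [h, div_eq_iff (by positivity)]
    simp
  have hmaps : MapsTo (fun w => (f w).im / (2 * π)) S (range ((↑) : ℤ → ℝ)) := by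
    intro w hw
    obtain ⟨n, hn⟩ := hval w hw
    exact ⟨n, (him' w n hn).symm⟩
  have hconst := hS.constant_of_mapsTo ⟨hd⟩
    ((Complex.continuous_im.comp_continuousOn hf).div_const (2 * π)) hmaps hz h₀
  obtain ⟨n, hn⟩ := hval z hz
  have h1 := him' z n hn
  simp only [Function.comp_apply, him, zero_div] at hconst
  rw [hconst] at h1
  have hn0 : n = 0 := by exact_mod_cast h1.symm
  rw [hn, hn0, Int.cast_zero, zero_mul]

/-! ### Shifted periodic Bernoulli functions. -/

/-- The `n`-th periodic Bernoulli function, shifted by one half. -/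
noncomputable def beta (n : ℕ) (u : ℝ) : ℝ := bernoulliFun n (Int.fract (u + 1 / 2))

theorem continuous_beta {n : ℕ} (hn : n ≠ 1) : Continuous (beta n) := by
  have h : Continuous (bernoulliFun n ∘ Int.fract) :=
    ContinuousOn.comp_fract'' (continuous_bernoulliFun n).continuousOn
      (bernoulliFun_endpoints_eq_of_ne_one hn).symm
  exact h.comp (by fun_prop : Continuous fun u : ℝ => u + 1 / 2)

theorem beta_add_one (n : ℕ) (u : ℝ) : beta n (u + 1) = beta n u := by
  rw [beta, add_right_comm, Int.fract_add_one, beta]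

theorem fract_mem_Icc (u : ℝ) : Int.fract u ∈ Icc (0 : ℝ) 1 :=
  ⟨Int.fract_nonneg _, (Int.fract_lt_one _).le⟩

theorem exists_abs_beta_le (n : ℕ) : ∃ C, 0 ≤ C ∧ ∀ u, |beta n u| ≤ C := by
  obtain ⟨C, hC⟩ := isCompact_Icc.exists_bound_of_continuousOn
    (continuous_bernoulliFun n).continuousOn (s := Icc (0 : ℝ) 1)
  exact ⟨C, (norm_nonneg _).trans (hC 0 (by simp)), fun u => hC _ (fract_mem_Icc _)⟩

theorem abs_beta_even_le {k : ℕ} (hk : k ≠ 0) (u : ℝ) :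
    |beta (2 * k) u| ≤ |(bernoulli (2 * k) : ℝ)| :=
  abs_bernoulliFun_even_le hk (fract_mem_Icc _)

/-- The boundary value in the integrations by parts; its factor is the one that turns T_j into T̂_j.
-/
theorem beta_zero (n : ℕ) : beta n 0 = (2 / 2 ^ n - 1) * bernoulli n := by
  rw [beta, zero_add, Int.fract_eq_self.2 (by norm_num), one_div, bernoulliFun_eval_half]

theorem beta_odd_zero (k : ℕ) : beta (2 * k + 1) 0 = 0 := by
  rw [beta, zero_add, Int.fract_eq_self.2 (by norm_num), one_div, bernoulliFun_eval_half_eq_zero]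

/-- The constant 1/12 makes the function the squared distance to the nearest integer. -/
theorem beta_two_of_le_half {u : ℝ} (h0 : 0 ≤ u) (h : u ≤ 1 / 2) : beta 2 u + 1 / 12 = u ^ 2 := by
  rcases h.lt_or_eq with h | rfl
  · rw [beta, Int.fract_eq_self.2 ⟨by linarith, by linarith⟩, bernoulliFun_two]
    ring
  · norm_num [beta, bernoulliFun_two]

theorem beta_two_of_half_le {u : ℝ} (h : 1 / 2 ≤ u) (h1 : u ≤ 1) :
    beta 2 u + 1 / 12 = (1 - u) ^ 2 := by
  have : Int.fract (u + 1 / 2) = u - 1 / 2 := by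
    rw [Int.fract_eq_iff]
    exact ⟨by linarith, by linarith, 1, by push_cast; ring⟩
  rw [beta, this, bernoulliFun_two]
  ring

theorem hasDerivWithinAt_fract (x : ℝ) : HasDerivWithinAt Int.fract 1 (Ioi x) x := by
  have h : HasDerivWithinAt (fun y : ℝ => y - ⌊x⌋) 1 (Ioi x) x :=
    ((hasDerivAt_id x).sub_const _).hasDerivWithinAt
  refine h.congr_of_eventuallyEq ?_ rfl
  filter_upwards [Ioo_mem_nhdsGT (Int.lt_floor_add_one x)] with y hy
  rw [Int.fract_eq_iff]
  exact ⟨by linarith [Int.floor_le x, hy.1], by linarith [hy.2], ⌊x⌋, by ring⟩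

/-- Right derivatives exist everywhere, including at the half-integers where the fractional part
jumps, and they suffice for the fundamental theorem of calculus for continuous functions. -/
theorem hasDerivWithinAt_beta (n : ℕ) (u : ℝ) :
    HasDerivWithinAt (beta (n + 1)) ((n + 1) * beta n u) (Ioi u) u := by
  have h1 : HasDerivWithinAt (fun u : ℝ => u + 1 / 2) 1 (Ioi u) u :=
    ((hasDerivAt_id u).add_const _).hasDerivWithinAt
  have h2 := (hasDerivWithinAt_fract (u + 1 / 2)).comp u h1
    (fun y (hy : u < y) => by simpa using hy)
  have h3 := (hasDerivAt_bernoulliFun (n + 1) (Int.fract (u + 1 / 2))).comp_hasDerivWithinAt u h2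
  refine h3.congr_deriv ?_
  simp [beta]

theorem integral_Ioi_of_hasDerivWithinAt_Ioi {f f' : ℝ → ℂ} {m : ℂ} (hc : ContinuousOn f (Ici 0))
    (hd : ∀ x ∈ Ioi (0 : ℝ), HasDerivWithinAt f (f' x) (Ioi x) x)
    (hint : IntegrableOn f' (Ioi 0)) (hlim : Tendsto f atTop (𝓝 m)) :
    ∫ x in Ioi (0 : ℝ), f' x = m - f 0 := by
  refine tendsto_nhds_unique (intervalIntegral_tendsto_integral_Ioi 0 hint tendsto_id) ?_
  refine (hlim.sub_const (f 0)).congr' ?_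
  filter_upwards [eventually_ge_atTop 0] with b hb
  change _ = ∫ x in (0 : ℝ)..b, f' x
  symm
  apply intervalIntegral.integral_eq_sub_of_hasDeriv_right_of_le hb
    (hc.mono Icc_subset_Ici_self) (fun x hx => hd x hx.1)
  rw [intervalIntegrable_iff_integrableOn_Ioc_of_le hb]
  exact hint.mono_set Ioc_subset_Ioi_self

/-! ### Bernoulli integrals on the closed right half plane. -/

/-- The closed right half plane without the origin. -/
def rightHalf : Set ℂ := {z | 0 ≤ z.re ∧ z ≠ 0}

theorem isPreconnected_rightHalf : IsPreconnected rightHalf := by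
  have h : IsPreconnected {z : ℂ | 0 < z.re} := (convex_halfSpace_re_gt 0).isPreconnected
  refine h.subset_closure (fun z hz => ⟨le_of_lt hz, fun h0 => ?_⟩) (fun z hz => ?_)
  · simp [h0] at hz
  · rw [Complex.closure_setOfPred_lt_re]
    exact hz.1

section

variable {z : ℂ}

theorem mem_slitPlane_of_rightHalf (hz : z ∈ rightHalf) : z ∈ Complex.slitPlane := by
  rw [Complex.mem_slitPlane_iff]
  rcases hz.1.lt_or_eq with h | h
  · exact Or.inl h
  · exact Or.inr fun hi => hz.2 (Complex.ext h.symm hi)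

theorem add_mem_rightHalf (hz : z ∈ rightHalf) {u : ℝ} (hu : 0 ≤ u) : (u : ℂ) + z ∈ rightHalf := by
  refine ⟨by simpa using add_nonneg hu hz.1, fun h => hz.2 ?_⟩
  have hre := congrArg Complex.re h
  have him := congrArg Complex.im h
  simp at hre him
  exact Complex.ext (by simp; linarith [hz.1]) him

theorem norm_pos_of_rightHalf (hz : z ∈ rightHalf) : 0 < ‖z‖ := norm_pos_iff.2 hz.2

/-- The cross term 2u Re z is nonnegative. It vanishes on the imaginary axis, so nothing is lost
there. -/
theorem sq_add_sq_le_norm_sq (hz : z ∈ rightHalf) {u : ℝ} (hu : 0 ≤ u) :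
    u ^ 2 + ‖z‖ ^ 2 ≤ ‖(u : ℂ) + z‖ ^ 2 := by
  rw [Complex.sq_norm, Complex.sq_norm, Complex.normSq_apply, Complex.normSq_apply]
  simp
  nlinarith [mul_nonneg hu hz.1]

theorem norm_le_norm_add (hz : z ∈ rightHalf) {u : ℝ} (hu : 0 ≤ u) : ‖z‖ ≤ ‖(u : ℂ) + z‖ := by
  have := sq_add_sq_le_norm_sq hz hu
  exact abs_le_of_sq_le_sq' (by nlinarith) (norm_nonneg _) |>.2

theorem aestronglyMeasurable_div_pow {b : ℝ → ℝ} (hb : Continuous b) (hz : z ∈ rightHalf) (n : ℕ) :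
    AEStronglyMeasurable (fun u : ℝ => (b u : ℂ) / ((u : ℂ) + z) ^ n) (volume.restrict (Ioi 0)) := by
  refine ContinuousOn.aestronglyMeasurable ?_ measurableSet_Ioi
  refine ContinuousOn.div (by fun_prop) (by fun_prop) fun u hu => ?_
  exact pow_ne_zero _ (add_mem_rightHalf hz (le_of_lt hu)).2

theorem norm_div_pow_le {C : ℝ} {x : ℝ} (hx : |x| ≤ C) (hz : z ∈ rightHalf) (n : ℕ)
    {u : ℝ} (hu : 0 ≤ u) :
    ‖(x : ℂ) / ((u : ℂ) + z) ^ (n + 2)‖ ≤ C / ‖z‖ ^ n * ((u ^ 2 + ‖z‖ ^ 2) ^ 1)⁻¹ := by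
  have hz0 := norm_pos_of_rightHalf hz
  rw [norm_div, Complex.norm_real, norm_pow, Real.norm_eq_abs, ← div_eq_mul_inv, div_div, pow_one]
  refine div_le_div₀ ((abs_nonneg _).trans hx) hx (by positivity) ?_
  rw [pow_add]
  exact mul_le_mul (pow_le_pow_left₀ hz0.le (norm_le_norm_add hz hu) n) (sq_add_sq_le_norm_sq hz hu)
    (by positivity) (by positivity)

theorem integrableOn_div_pow {b : ℝ → ℝ} (hb : Continuous b) {C : ℝ} (hC : ∀ u, |b u| ≤ C)
    (hz : z ∈ rightHalf) (n : ℕ) :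
    IntegrableOn (fun u : ℝ => (b u : ℂ) / ((u : ℂ) + z) ^ (n + 2)) (Ioi 0) := by
  have h := (integrableOn_inv_sq_add_sq_pow (norm_pos_of_rightHalf hz) one_ne_zero).const_mul
    (C / ‖z‖ ^ n)
  refine Integrable.mono' h (aestronglyMeasurable_div_pow hb hz _) ?_
  exact (ae_restrict_mem measurableSet_Ioi).mono fun u hu =>
    norm_div_pow_le (hC u) hz n (le_of_lt hu)

/-- `∫₀^∞ β_n(u) / (u + z)^n du`. -/
noncomputable def bernoulliIntegral (n : ℕ) (z : ℂ) : ℂ :=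
  ∫ u in Ioi (0 : ℝ), (beta n u : ℂ) / ((u : ℂ) + z) ^ n

theorem integrableOn_beta_div (hz : z ∈ rightHalf) {m n : ℕ} (hm : m ≠ 1) (hn : 2 ≤ n) :
    IntegrableOn (fun u : ℝ => (beta m u : ℂ) / ((u : ℂ) + z) ^ n) (Ioi 0) := by
  obtain ⟨C, -, hC⟩ := exists_abs_beta_le m
  obtain ⟨l, rfl⟩ := Nat.exists_eq_add_of_le' hn
  exact integrableOn_div_pow (continuous_beta hm) hC hz l

theorem hasDerivAt_add_ofReal (z : ℂ) (u : ℝ) : HasDerivAt (fun u : ℝ => (u : ℂ) + z) 1 u :=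
  (hasDerivAt_id u).ofReal_comp.add_const z

theorem tendsto_norm_add_ofReal (z : ℂ) : Tendsto (fun u : ℝ => ‖(u : ℂ) + z‖) atTop atTop := by
  refine tendsto_atTop_mono (fun u => ?_) (tendsto_atTop_add_const_right atTop (-‖z‖) tendsto_id)
  have h := norm_sub_norm_le (u : ℂ) (-z)
  rw [sub_neg_eq_add, norm_neg, Complex.norm_real] at h
  have := le_abs_self u
  simp only [id, Real.norm_eq_abs] at *
  linarith

/-- Integration by parts; the boundary term at infinity vanishes because the periodic function is
bounded. -/
theorem bernoulliIntegral_succ (hz : z ∈ rightHalf) {n : ℕ} (hn : 2 ≤ n) :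
    bernoulliIntegral n z / n = -(beta (n + 1) 0 : ℂ) / (n * (n + 1) * z ^ n) +
      bernoulliIntegral (n + 1) z / ((n + 1 : ℕ) : ℂ) := by
  have hn0 : (n : ℂ) ≠ 0 := by exact_mod_cast (by omega : n ≠ 0)
  have hn1 : (n : ℂ) + 1 ≠ 0 := by exact_mod_cast n.succ_ne_zero
  obtain ⟨C, hC0, hC⟩ := exists_abs_beta_le (n + 1)
  have hI1 := integrableOn_beta_div hz (by omega : n ≠ 1) hn
  have hI2 := (integrableOn_beta_div hz (by omega : n + 1 ≠ 1) (by omega : 2 ≤ n + 1)).const_mul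
    ((n : ℂ) / (n + 1))
  have h := integral_Ioi_of_hasDerivWithinAt_Ioi
    (f := fun u : ℝ => (beta (n + 1) u : ℂ) / ((n + 1) * ((u : ℂ) + z) ^ n))
    (f' := fun u : ℝ => (beta n u : ℂ) / ((u : ℂ) + z) ^ n -
      (n : ℂ) / (n + 1) * ((beta (n + 1) u : ℂ) / ((u : ℂ) + z) ^ (n + 1))) (m := 0) ?_ ?_
    (hI1.sub hI2) ?_
  · rw [integral_sub hI1 hI2, integral_const_mul] at h
    change bernoulliIntegral n z - _ * bernoulliIntegral (n + 1) z = _ at h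
    have hz0 := hz.2
    rw [Complex.ofReal_zero, zero_add, zero_sub, sub_eq_iff_eq_add] at h
    rw [h]
    push_cast
    field_simp
  · have := continuous_beta (by omega : n + 1 ≠ 1)
    refine ContinuousOn.div (by fun_prop) (by fun_prop) fun u hu => ?_
    exact mul_ne_zero hn1 (pow_ne_zero _ (add_mem_rightHalf hz hu).2)
  · intro u hu
    have hu0 := (add_mem_rightHalf hz (le_of_lt hu)).2
    have h1 := (hasDerivWithinAt_beta n u).ofReal_comp
    have h2 := ((hasDerivAt_add_ofReal z u).pow n).hasDerivWithinAt (s := Ioi u)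
    refine (h1.div (h2.const_mul ((n : ℂ) + 1))
      (mul_ne_zero hn1 (pow_ne_zero _ hu0))).congr_deriv ?_
    obtain ⟨m, rfl⟩ := Nat.exists_eq_succ_of_ne_zero (by omega : n ≠ 0)
    simp only [Nat.succ_eq_add_one, Nat.add_sub_cancel, Pi.pow_apply]
    push_cast at hn1 ⊢
    field_simp
    ring
  · rw [tendsto_zero_iff_norm_tendsto_zero]
    have hlim : Tendsto (fun u : ℝ => C / ‖(u : ℂ) + z‖ ^ n) atTop (𝓝 0) :=
      tendsto_const_nhds.div_atTop
        ((tendsto_pow_atTop (by omega)).comp (tendsto_norm_add_ofReal z))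
    refine squeeze_zero' (Eventually.of_forall fun _ => norm_nonneg _) ?_ hlim
    filter_upwards [eventually_ge_atTop 0] with u hu
    have hu0 := norm_pos_of_rightHalf (add_mem_rightHalf hz hu)
    rw [norm_div, Complex.norm_real, norm_mul, norm_pow]
    refine div_le_div₀ hC0 (hC u) (by positivity) (le_mul_of_one_le_left (by positivity) ?_)
    rw [← Nat.cast_add_one, Complex.norm_natCast]
    exact_mod_cast (by omega)

theorem norm_bernoulliIntegral_even_le (hz : z ∈ rightHalf) {k : ℕ} (hk : k ≠ 0) :
    ‖bernoulliIntegral (2 * k) z‖ ≤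
      |(bernoulli (2 * k) : ℝ)| * ∫ u in Ioi (0 : ℝ), ((u ^ 2 + ‖z‖ ^ 2) ^ k)⁻¹ := by
  have hI := (integrableOn_inv_sq_add_sq_pow (norm_pos_of_rightHalf hz) hk).const_mul
    |(bernoulli (2 * k) : ℝ)|
  rw [← integral_const_mul]
  refine norm_integral_le_of_norm_le hI ?_
  refine (ae_restrict_mem measurableSet_Ioi).mono fun u hu => ?_
  have hz0 := norm_pos_of_rightHalf hz
  rw [norm_div, Complex.norm_real, norm_pow, pow_mul, ← div_eq_mul_inv]
  exact div_le_div₀ (abs_nonneg _) (abs_beta_even_le hk u) (by positivity)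
    (pow_le_pow_left₀ (by positivity) (sq_add_sq_le_norm_sq hz (le_of_lt hu)) k)

end

/-! ### Duplication, reflection and the theta function. -/

theorem lnGamma_two_mul {z : ℂ} (hz : z ∈ Complex.slitPlane) :
    lnGamma (2 * z) = lnGamma z + lnGamma (z + 1 / 2) +
      ((2 * z - 1) * Real.log 2 - 1 / 2 * Real.log π : ℂ) := by
  have h2 : ∀ w ∈ Complex.slitPlane, 2 * w ∈ Complex.slitPlane := fun w hw => by
    rw [Complex.mem_slitPlane_iff] at hw ⊢
    simpa using hw
  have h3 : ∀ w ∈ Complex.slitPlane, w + 1 / 2 ∈ Complex.slitPlane := fun w hw => by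
    rw [Complex.mem_slitPlane_iff] at hw ⊢
    rcases hw with h | h
    · exact Or.inl (by simp; linarith)
    · exact Or.inr (by simpa using h)
  have hc := differentiableOn_lnGamma.continuousOn
  have hcont : ContinuousOn (fun w => lnGamma (2 * w) - (lnGamma w + lnGamma (w + 1 / 2) +
      ((2 * w - 1) * Real.log 2 - 1 / 2 * Real.log π : ℂ))) Complex.slitPlane :=
    (hc.comp (by fun_prop) h2).sub ((hc.add (hc.comp (by fun_prop) h3)).add (by fun_prop))
  refine sub_eq_zero.1 (eq_zero_of_exp_eq_one
    (Complex.starConvex_one_slitPlane.isPathConnected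
      Complex.one_mem_slitPlane).isConnected.isPreconnected hcont (fun w hw => ?_)
    Complex.one_mem_slitPlane ?_ hz)
  · have hG := Complex.Gamma_mul_Gamma_add_half w
    have hne : Complex.Gamma (2 * w) ≠ 0 :=
      Complex.Gamma_ne_zero (ne_neg_nat_of_mem_slitPlane (h2 w hw))
    have hsqrt : ((√π : ℝ) : ℂ) = Complex.exp (1 / 2 * Real.log π) := by
      rw [Real.sqrt_eq_rpow, Real.rpow_def_of_pos pi_pos, Complex.ofReal_exp]
      push_cast
      ring_nf
    have h2log : Complex.log 2 = Real.log 2 := by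
      rw [Complex.ofReal_log (by norm_num)]; norm_num
    rw [Complex.exp_sub, Complex.exp_add, Complex.exp_add, exp_lnGamma hw, exp_lnGamma (h2 w hw),
      exp_lnGamma (h3 w hw), hG, hsqrt, Complex.cpow_def_of_ne_zero two_ne_zero, h2log,
      mul_assoc, mul_assoc, ← Complex.exp_add, ← Complex.exp_add]
    rw [mul_comm 2 w] at hne
    ring_nf
    rw [Complex.exp_zero, inv_one, mul_one, mul_inv_cancel₀ hne]
  · have e1 := lnGamma_ofReal (x := 2) (by norm_num)
    have e2 := lnGamma_ofReal (x := 3 / 2) (by norm_num)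
    push_cast at e1 e2
    have e3 : (1 : ℂ) + 1 / 2 = 3 / 2 := by norm_num
    have e4 : ((Real.log (Real.Gamma 2) : ℝ) : ℂ) - (0 + (Real.log (Real.Gamma (3 / 2)) : ℝ) +
        ((2 * 1 - 1) * (Real.log 2 : ℝ) - 1 / 2 * (Real.log π : ℝ))) =
        ((Real.log (Real.Gamma 2) - (Real.log (Real.Gamma (3 / 2)) +
          (Real.log 2 - 1 / 2 * Real.log π)) : ℝ) : ℂ) := by
      push_cast; ring
    simp only [e3, lnGamma_one, mul_one, e1, e2] at e4 ⊢
    rw [e4, Complex.ofReal_im]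

theorem exp_neg_arctan_mul_I (q : ℝ) :
    Complex.exp (-(arctan q : ℂ) * Complex.I) = (1 - q * Complex.I) / (√(1 + q ^ 2) : ℝ) := by
  rw [← Complex.ofReal_neg, Complex.exp_mul_I, ← Complex.ofReal_cos, ← Complex.ofReal_sin,
    Real.cos_neg, Real.sin_neg, cos_arctan, sin_arctan]
  push_cast
  ring

theorem sin_pi_mul_quarter_add (s : ℝ) :
    Complex.sin (π * (Complex.I * (s : ℂ) / 2 + 1 / 4)) =
      1 / 2 * (exp (π * s / 2) : ℝ) * Complex.exp ((π / 4 : ℝ) * Complex.I) *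
        (1 - (exp (-(π * s)) : ℝ) * Complex.I) := by
  rw [Complex.sin, Complex.ofReal_exp, Complex.ofReal_exp]
  have e1 : Complex.exp (-(π * (Complex.I * (s : ℂ) / 2 + 1 / 4)) * Complex.I) * Complex.I =
      Complex.exp ((π / 4 : ℝ) * Complex.I) * Complex.exp ((π * s / 2 : ℝ)) := by
    nth_rewrite 3 [← Complex.exp_pi_div_two_mul_I]
    rw [← Complex.exp_add, ← Complex.exp_add]
    congr 1
    push_cast
    linear_combination (-(π * s / 2 : ℂ)) * Complex.I_sq
  have e2 : Complex.exp ((π * (Complex.I * (s : ℂ) / 2 + 1 / 4)) * Complex.I) =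
      Complex.exp ((π / 4 : ℝ) * Complex.I) *
        (Complex.exp ((π * s / 2 : ℝ)) * Complex.exp ((-(π * s) : ℝ))) := by
    rw [← Complex.exp_add, ← Complex.exp_add]
    congr 1
    push_cast
    linear_combination (π * s / 2 : ℂ) * Complex.I_sq
  rw [sub_mul, e1, e2]
  ring

/-- With s = it/2 + 1/4, reflection reads Γ(s) · conj Γ(s + 1/2) = π / sin πs, and sin πs has
argument π/4 - arctan e^{-πt}. Continuity in t, with all arguments real at t = 0, selects the
branch. -/
theorem im_lnGamma_sub_im_lnGamma (t : ℝ) :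
    (lnGamma (Complex.I * (t : ℂ) / 2 + 1 / 4)).im -
      (lnGamma (Complex.I * (t : ℂ) / 2 + 1 / 4 + 1 / 2)).im + π / 4 -
        arctan (exp (-(π * t))) = 0 := by
  have hmem : ∀ s : ℝ, Complex.I * (s : ℂ) / 2 + 1 / 4 + 1 / 2 ∈ Complex.slitPlane :=
    fun s => Complex.mem_slitPlane_iff.2 (Or.inl (by simp; norm_num))
  have hc1 : Continuous fun s : ℝ => lnGamma (Complex.I * (s : ℂ) / 2 + 1 / 4) :=
    differentiableOn_lnGamma.continuousOn.comp_continuous (by fun_prop) arg_mem_slitPlane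
  have hc2 : Continuous fun s : ℝ => lnGamma (Complex.I * (s : ℂ) / 2 + 1 / 4 + 1 / 2) :=
    differentiableOn_lnGamma.continuousOn.comp_continuous (by fun_prop) hmem
  set g : ℝ → ℝ := fun s => (lnGamma (Complex.I * (s : ℂ) / 2 + 1 / 4)).im -
      (lnGamma (Complex.I * (s : ℂ) / 2 + 1 / 4 + 1 / 2)).im + π / 4 -
        arctan (exp (-(π * s))) with hg
  have hgc : Continuous g := by
    have h1 := Complex.continuous_im.comp hc1
    have h2 := Complex.continuous_im.comp hc2
    exact ((h1.sub h2).add_const _).sub (by fun_prop)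
  have h := eq_zero_of_exp_eq_one (f := fun s => (g s : ℂ) * Complex.I) isPreconnected_univ
    (by fun_prop) (fun s _ => ?_) (mem_univ 0) ?_ (mem_univ t)
  · have : g t = 0 := by simpa using h
    exact this
  · set L₁ := lnGamma (Complex.I * (s : ℂ) / 2 + 1 / 4)
    set L₂ := lnGamma (Complex.I * (s : ℂ) / 2 + 1 / 4 + 1 / 2)
    set q := exp (-(π * s))
    have hrefl := Complex.Gamma_mul_Gamma_one_sub (Complex.I * (s : ℂ) / 2 + 1 / 4)
    have hconj : (1 : ℂ) - (Complex.I * (s : ℂ) / 2 + 1 / 4) =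
        (starRingEnd ℂ) (Complex.I * (s : ℂ) / 2 + 1 / 4 + 1 / 2) := by
      rw [show Complex.I * (s : ℂ) / 2 + 1 / 4 + 1 / 2 =
        ((3 / 4 : ℝ) : ℂ) + ((s / 2 : ℝ) : ℂ) * Complex.I by push_cast; ring, map_add, map_mul,
        Complex.conj_ofReal, Complex.conj_ofReal, Complex.conj_I]
      push_cast
      ring
    have hne : Complex.sin (π * (Complex.I * (s : ℂ) / 2 + 1 / 4)) ≠ 0 := by
      intro h0
      rw [h0, div_zero] at hrefl
      refine mul_ne_zero ?_ ?_ hrefl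
      · exact Complex.Gamma_ne_zero (ne_neg_nat_of_mem_slitPlane (arg_mem_slitPlane s))
      · rw [hconj, Complex.Gamma_conj]
        exact (map_ne_zero _).2
          (Complex.Gamma_ne_zero (ne_neg_nat_of_mem_slitPlane (hmem s)))
    rw [hconj, Complex.Gamma_conj, ← exp_lnGamma (arg_mem_slitPlane s), ← exp_lnGamma (hmem s),
      ← Complex.exp_conj, ← Complex.exp_add, eq_div_iff hne, sin_pi_mul_quarter_add] at hrefl
    have hL : Complex.exp ((g s : ℂ) * Complex.I) = Complex.exp (L₁ + (starRingEnd ℂ) L₂) *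
        Complex.exp ((-(L₁.re + L₂.re) : ℝ)) * Complex.exp ((π / 4 : ℝ) * Complex.I) *
          Complex.exp (-(arctan q : ℂ) * Complex.I) := by
      rw [← Complex.exp_add, ← Complex.exp_add, ← Complex.exp_add]
      congr 1
      apply Complex.ext <;> simp [hg, L₁, L₂, q] <;> ring
    have hr : Complex.exp ((g s : ℂ) * Complex.I) =
        ((π * exp (-(L₁.re + L₂.re)) * 2 / (exp (π * s / 2) * √(1 + q ^ 2)) : ℝ) : ℂ) := by
      rw [hL, exp_neg_arctan_mul_I, ← Complex.ofReal_exp]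
      have h1 : ((√(1 + q ^ 2) : ℝ) : ℂ) ≠ 0 := by
        exact_mod_cast (Real.sqrt_pos.2 (by positivity)).ne'
      have h2 : ((exp (π * s / 2) : ℝ) : ℂ) ≠ 0 := by exact_mod_cast (exp_pos _).ne'
      simp only [Complex.ofReal_div, Complex.ofReal_mul, Complex.ofReal_ofNat]
      have alg : ∀ P X Z E Q S Y : ℂ, S ≠ 0 → E ≠ 0 →
          X * (1 / 2 * E * Z * (1 - Q * Complex.I)) = P →
          X * Y * Z * ((1 - Q * Complex.I) / S) = P * Y * 2 / (E * S) := by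
        intro P X Z E Q S Y hS hE h
        rw [← h]
        field_simp
      simp only [Complex.ofReal_div, Complex.ofReal_ofNat] at hrefl
      exact alg _ _ _ _ _ _ _ h1 h2 hrefl
    -- exp(i g(s)) is a nonnegative real of modulus one, hence equal to 1.
    have hn := congrArg norm hr
    rw [Complex.norm_exp_ofReal_mul_I, Complex.norm_real, norm_of_nonneg (by positivity)] at hn
    rw [hr, ← hn, Complex.ofReal_one]
  · have e1 := lnGamma_ofReal (x := 1 / 4) (by norm_num)
    have e2 := lnGamma_ofReal (x := 3 / 4) (by norm_num)
    push_cast at e1 e2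
    have e3 : (1 / 4 : ℂ) + 1 / 2 = 3 / 4 := by norm_num
    have e4 : g 0 = 0 := by
      simp only [hg, Complex.ofReal_zero, mul_zero, zero_div, zero_add, e1, e3, e2, neg_zero,
        Real.exp_zero, arctan_one, Complex.ofReal_im]
      ring
    simp [e4]

theorem theta_eq (t : ℝ) : theta t = 1 / 2 * (lnGamma (Complex.I * (t : ℂ) + 1 / 2)).im -
    t / 2 * Real.log (2 * π) - π / 8 + 1 / 2 * arctan (exp (-(π * t))) := by
  have h1 := im_lnGamma_sub_im_lnGamma t
  have h2 := congrArg Complex.im (lnGamma_two_mul (arg_mem_slitPlane t))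
  rw [show 2 * (Complex.I * (t : ℂ) / 2 + 1 / 4) = Complex.I * (t : ℂ) + 1 / 2 by ring,
    Complex.add_im, Complex.add_im] at h2
  have h3 : ((Complex.I * (t : ℂ) + 1 / 2 - 1) * (Real.log 2 : ℝ) -
      1 / 2 * (Real.log π : ℝ)).im = t * Real.log 2 := by
    generalize Real.log 2 = a
    generalize Real.log π = b
    simp
  rw [h3] at h2
  rw [theta, Real.log_mul two_ne_zero pi_ne_zero]
  linarith

/-! ### Gauss's form of Stirling's formula. -/

/-- The primitive `w log w - w` of the logarithm. -/
noncomputable def mulLogSub (w : ℂ) : ℂ := w * Complex.log w - w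

theorem hasDerivAt_mulLogSub {w : ℂ} (hw : w ∈ Complex.slitPlane) :
    HasDerivAt mulLogSub (Complex.log w) w := by
  have hw0 := Complex.slitPlane_ne_zero hw
  refine (((hasDerivAt_id w).mul (Complex.hasDerivAt_log hw)).sub (hasDerivAt_id w)).congr_deriv ?_
  simp only [id]
  field_simp
  ring

/-- The integrand of the remainder in Gauss's form of Stirling's formula. -/
noncomputable def gaussIntegrand (z : ℂ) (u : ℝ) : ℂ :=
  ((beta 2 u + 1 / 12 : ℝ) : ℂ) / ((u : ℂ) + z) ^ 2

/-- The remainder `1/2 ∫₀^∞ (β₂(u) + 1/12) / (u + z)² du` in Gauss's form of Stirling's formula. -/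
noncomputable def gaussRemainder (z : ℂ) : ℂ :=
  1 / 2 * ∫ u in Ioi (0 : ℝ), gaussIntegrand z u

theorem abs_beta_two_add_le (u : ℝ) : |beta 2 u + 1 / 12| ≤ 1 / 4 := by
  have h := abs_beta_even_le one_ne_zero u
  have e : ((bernoulli (2 * 1) : ℚ) : ℝ) = 1 / 6 := by
    rw [mul_one, bernoulli_two]; norm_num
  rw [e, abs_of_pos (by norm_num : (0 : ℝ) < 1 / 6), mul_one] at h
  rw [abs_le] at h ⊢
  constructor <;> linarith

theorem continuous_beta_two_add : Continuous fun u => beta 2 u + 1 / 12 :=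
  (continuous_beta (by norm_num)).add continuous_const

section

variable {z : ℂ}

theorem integrableOn_gaussIntegrand (hz : z ∈ rightHalf) :
    IntegrableOn (gaussIntegrand z) (Ioi 0) :=
  integrableOn_div_pow continuous_beta_two_add abs_beta_two_add_le hz 0

theorem norm_gaussRemainder_le (hz : z ∈ rightHalf) : ‖gaussRemainder z‖ ≤ π / (16 * ‖z‖) := by
  have hz0 := norm_pos_of_rightHalf hz
  have hI := (integrableOn_inv_sq_add_sq_pow hz0 one_ne_zero).const_mul (1 / 4 / ‖z‖ ^ 0)
  have h := norm_integral_le_of_norm_le hI ((ae_restrict_mem measurableSet_Ioi).mono fun u hu =>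
    norm_div_pow_le (abs_beta_two_add_le u) hz 0 (le_of_lt hu))
  have h2 := integral_inv_sq_add_sq_pow hz0 one_ne_zero
  rw [gammaRatio_one] at h2
  rw [integral_const_mul] at h
  norm_num at h2
  rw [gaussRemainder, norm_mul]
  change ‖(1 / 2 : ℂ)‖ * ‖∫ u in Ioi (0 : ℝ), ((beta 2 u + 1 / 12 : ℝ) : ℂ) / ((u : ℂ) + z) ^ (0 + 2)‖ ≤ _
  rw [le_div_iff₀ (by positivity)]
  norm_num at h ⊢
  nlinarith

theorem integral_gaussIntegrand_zero_one (hz : z ∈ rightHalf) :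
    ∫ u in (0 : ℝ)..1, gaussIntegrand z u =
      2 * (Complex.log (z + 1 / 2) - mulLogSub (z + 1) + mulLogSub z) := by
  have hmem : ∀ {u : ℝ}, 0 ≤ u → (u : ℂ) + z ∈ Complex.slitPlane := fun hu =>
    mem_slitPlane_of_rightHalf (add_mem_rightHalf hz hu)
  have hint : IntervalIntegrable (gaussIntegrand z) volume 0 1 := by
    refine ContinuousOn.intervalIntegrable ?_
    refine ContinuousOn.div
      (Complex.continuous_ofReal.comp continuous_beta_two_add).continuousOn (by fun_prop) fun u hu => ?_
    rw [uIcc_of_le zero_le_one] at hu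
    exact pow_ne_zero _ (add_mem_rightHalf hz hu.1).2
  have hlog : ∀ {u : ℝ}, 0 ≤ u → HasDerivAt (fun u : ℝ => Complex.log ((u : ℂ) + z))
      (((u : ℂ) + z)⁻¹) u := fun {u} hu => by
    have h := (Complex.hasDerivAt_log (hmem hu)).comp u (hasDerivAt_add_ofReal z u)
    rw [mul_one] at h
    exact h
  have hA : ∀ {u : ℝ}, 0 ≤ u → HasDerivAt (fun u : ℝ => mulLogSub ((u : ℂ) + z))
      (Complex.log ((u : ℂ) + z)) u := fun {u} hu => by
    have h := (hasDerivAt_mulLogSub (hmem hu)).comp u (hasDerivAt_add_ofReal z u)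
    rw [mul_one] at h
    exact h
  have hsub1 : uIcc (0 : ℝ) (1 / 2) ⊆ uIcc 0 1 := by
    rw [uIcc_of_le (by norm_num), uIcc_of_le (by norm_num)]
    exact Icc_subset_Icc_right (by norm_num)
  have hsub2 : uIcc (1 / 2 : ℝ) 1 ⊆ uIcc 0 1 := by
    rw [uIcc_of_le (by norm_num), uIcc_of_le (by norm_num)]
    exact Icc_subset_Icc_left (by norm_num)
  -- The primitive comes from integrating (u - c)²/(u + z)² by parts twice; c is the nearest
  -- integer, 0 on the first half of [0, 1] and 1 on the second.
  have key : ∀ (c a b : ℝ), 0 ≤ a → a ≤ b → uIcc a b ⊆ uIcc 0 1 →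
      (∀ u ∈ Icc a b, beta 2 u + 1 / 12 = (u - c) ^ 2) →
      ∫ u in a..b, gaussIntegrand z u =
        (-((b - c : ℂ) ^ 2 / (b + z)) + 2 * (b - c) * Complex.log (b + z) - 2 * mulLogSub (b + z)) -
        (-((a - c : ℂ) ^ 2 / (a + z)) + 2 * (a - c) * Complex.log (a + z) - 2 * mulLogSub (a + z)) := by
    intro c a b ha hab hsub hbeta
    refine intervalIntegral.integral_eq_sub_of_hasDerivAt
      (f := fun u : ℝ => -((u - c : ℂ) ^ 2 / (u + z)) + 2 * (u - c) * Complex.log (u + z)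
        - 2 * mulLogSub (u + z)) (fun u hu => ?_) (hint.mono_set hsub)
    rw [uIcc_of_le hab] at hu
    have hu0 : 0 ≤ u := ha.trans hu.1
    have hne := Complex.slitPlane_ne_zero (hmem hu0)
    have hs : HasDerivAt (fun u : ℝ => (u : ℂ) - c) 1 u := (hasDerivAt_id u).ofReal_comp.sub_const _
    refine ((((hs.pow 2).div (hasDerivAt_add_ofReal z u) hne).neg.add
      ((hs.const_mul 2).mul (hlog hu0))).sub ((hA hu0).const_mul 2)).congr_deriv ?_
    rw [gaussIntegrand, hbeta u hu]
    simp only [Pi.pow_apply]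
    push_cast
    field_simp
    ring
  rw [← intervalIntegral.integral_add_adjacent_intervals (hint.mono_set hsub1) (hint.mono_set hsub2),
    key 0 0 (1 / 2) le_rfl (by norm_num) hsub1
      (fun u hu => by rw [beta_two_of_le_half hu.1 hu.2, sub_zero]),
    key 1 (1 / 2) 1 (by norm_num) (by norm_num) hsub2
      (fun u hu => by rw [beta_two_of_half_le hu.1 hu.2]; ring)]
  push_cast
  rw [add_comm (1 / 2 : ℂ) z, add_comm (1 : ℂ) z, zero_add]
  ring

theorem gaussIntegrand_add_one (z : ℂ) (u : ℝ) :
    gaussIntegrand z (u + 1) = gaussIntegrand (z + 1) u := by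
  rw [gaussIntegrand, gaussIntegrand, beta_add_one]
  push_cast
  ring_nf

/-- By periodicity, shifting z by 1 removes exactly the integral over [0, 1]. This makes
`gaussGamma` satisfy the functional equation of Γ(z + 1/2). -/
theorem gaussRemainder_sub_succ (hz : z ∈ rightHalf) :
    gaussRemainder z - gaussRemainder (z + 1) =
      Complex.log (z + 1 / 2) - mulLogSub (z + 1) + mulLogSub z := by
  have hI := integrableOn_gaussIntegrand hz
  have h1 : ∫ u in Ioi (0 : ℝ), gaussIntegrand z u = (∫ u in (0 : ℝ)..1, gaussIntegrand z u) +
      ∫ u in Ioi (1 : ℝ), gaussIntegrand z u :=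
    (intervalIntegral.integral_interval_add_Ioi hI (hI.mono_set (Ioi_subset_Ioi zero_le_one))).symm
  have h2 : ∫ u in Ioi (1 : ℝ), gaussIntegrand z u =
      ∫ u in Ioi (0 : ℝ), gaussIntegrand (z + 1) u := by
    have := (measurePreserving_add_right volume (1 : ℝ)).setIntegral_preimage_emb
      (measurableEmbedding_addRight 1) (gaussIntegrand z) (Ioi 1)
    rw [preimage_add_const_Ioi, sub_self] at this
    rw [← this]
    exact integral_congr_ae (ae_of_all _ fun u => gaussIntegrand_add_one z u)
  rw [gaussRemainder, gaussRemainder, h1, h2, integral_gaussIntegrand_zero_one hz]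
  ring

theorem continuousOn_gaussRemainder : ContinuousOn gaussRemainder rightHalf := by
  refine continuousOn_const.mul fun z₀ hz₀ => ?_
  have hr := norm_pos_of_rightHalf hz₀
  refine continuousWithinAt_of_dominated
    (bound := fun u => 1 / 4 / (‖z₀‖ / 2) ^ 0 * ((u ^ 2 + (‖z₀‖ / 2) ^ 2) ^ 1)⁻¹) ?_ ?_ ?_ ?_
  · exact eventually_mem_nhdsWithin.mono fun z hz =>
      aestronglyMeasurable_div_pow continuous_beta_two_add hz 2
  · have hev : ∀ᶠ z in 𝓝[rightHalf] z₀, ‖z₀‖ / 2 < ‖z‖ :=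
      nhdsWithin_le_nhds (continuous_norm.continuousAt.eventually_const_lt (by linarith))
    filter_upwards [hev, eventually_mem_nhdsWithin] with z h hz
    refine (ae_restrict_mem measurableSet_Ioi).mono fun u hu => ?_
    refine (norm_div_pow_le (abs_beta_two_add_le u) hz 0 (le_of_lt hu)).trans ?_
    rw [pow_zero, pow_zero]
    gcongr
  · exact (integrableOn_inv_sq_add_sq_pow (by positivity) one_ne_zero).const_mul _
  · refine (ae_restrict_mem measurableSet_Ioi).mono fun u hu => ?_
    refine ContinuousAt.continuousWithinAt ?_
    exact continuousAt_const.div (by fun_prop)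
      (pow_ne_zero _ (add_mem_rightHalf hz₀ (le_of_lt hu)).2)

/-- Gauss's form of Stirling's formula for `Γ(z + 1/2)`. -/
noncomputable def gaussGamma (z : ℂ) : ℂ :=
  (√(2 * π) : ℝ) * Complex.exp (mulLogSub z - gaussRemainder z)

theorem gaussGamma_ne_zero (z : ℂ) : gaussGamma z ≠ 0 :=
  mul_ne_zero (by exact_mod_cast (Real.sqrt_pos.2 (by positivity)).ne') (Complex.exp_ne_zero _)

theorem add_half_mem_slitPlane (hz : z ∈ rightHalf) : z + 1 / 2 ∈ Complex.slitPlane := by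
  have := mem_slitPlane_of_rightHalf (add_mem_rightHalf hz (u := 1 / 2) (by norm_num))
  push_cast at this
  rwa [add_comm]

theorem gaussGamma_add_one (hz : z ∈ rightHalf) :
    gaussGamma (z + 1) = (z + 1 / 2) * gaussGamma z := by
  have h := gaussRemainder_sub_succ hz
  have e : mulLogSub (z + 1) - gaussRemainder (z + 1) =
      Complex.log (z + 1 / 2) + (mulLogSub z - gaussRemainder z) := by
    linear_combination h
  rw [gaussGamma, e, Complex.exp_add,
    Complex.exp_log (Complex.slitPlane_ne_zero (add_half_mem_slitPlane hz)), gaussGamma]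
  ring

theorem add_nat_mem_rightHalf (hz : z ∈ rightHalf) (n : ℕ) : z + n ∈ rightHalf := by
  have := add_mem_rightHalf hz (u := n) (by positivity)
  rwa [add_comm, Complex.ofReal_natCast] at this

theorem prod_mul_gaussGamma (hz : z ∈ rightHalf) (n : ℕ) :
    (∏ j ∈ Finset.range n, (z + 1 / 2 + j)) * gaussGamma z = gaussGamma (z + n) := by
  induction n with
  | zero => simp
  | succ n ih =>
    rw [Finset.prod_range_succ, mul_right_comm, ih, Nat.cast_add_one, ← add_assoc,
      gaussGamma_add_one (add_nat_mem_rightHalf hz n)]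
    ring

theorem tendsto_gaussRemainder_add_nat (hz : z ∈ rightHalf) :
    Tendsto (fun n : ℕ => gaussRemainder (z + (n + 1 : ℕ))) atTop (𝓝 0) := by
  rw [tendsto_zero_iff_norm_tendsto_zero]
  have h1 : Tendsto (fun n : ℕ => ‖z + (n + 1 : ℕ)‖) atTop atTop := by
    have := (tendsto_norm_add_ofReal z).comp
      (tendsto_natCast_atTop_atTop.comp (tendsto_add_atTop_nat 1))
    refine this.congr fun n => ?_
    simp [add_comm]
  have h2 : Tendsto (fun n : ℕ => π / (16 * ‖z + (n + 1 : ℕ)‖)) atTop (𝓝 0) :=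
    tendsto_const_nhds.div_atTop (h1.const_mul_atTop (by norm_num))
  exact squeeze_zero (fun _ => norm_nonneg _)
    (fun n => norm_gaussRemainder_le (add_nat_mem_rightHalf hz (n + 1))) h2

/-- The functional equation evaluates the product in Euler's limit for Γ(z + 1/2), and n! is written
through `Stirling.stirlingSeq`. Each of the three factors multiplying `gaussGamma z` tends to 1. -/
theorem GammaSeq_add_half_eq (hz : z ∈ rightHalf) {n : ℕ} (hn : n ≠ 0) :
    Complex.GammaSeq (z + 1 / 2) n = gaussGamma z * (((Stirling.stirlingSeq n / √π : ℝ) : ℂ) *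
      Complex.exp (z + 1 - (z + 1) * Complex.log (1 + (z + 1) / (n : ℝ)) -
        (n : ℝ) * Complex.log (1 + (z + 1) / (n : ℝ))) *
      Complex.exp (gaussRemainder (z + (n + 1 : ℕ)))) := by
  have hn0 : (0 : ℝ) < n := by positivity
  have hnC : (n : ℂ) ≠ 0 := by exact_mod_cast hn
  have hprod := prod_mul_gaussGamma hz (n + 1)
  have hP : ∏ j ∈ Finset.range (n + 1), (z + 1 / 2 + (j : ℂ)) =
      gaussGamma (z + (n + 1 : ℕ)) / gaussGamma z := by
    rw [← hprod, mul_div_cancel_right₀ _ (gaussGamma_ne_zero z)]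
  have hlog : Complex.log (z + (n + 1 : ℕ)) =
      Real.log n + Complex.log (1 + (z + 1) / (n : ℝ)) := by
    have e : z + (n + 1 : ℕ) = (n : ℝ) * (1 + (z + 1) / (n : ℝ)) := by
      push_cast
      field_simp
      ring
    have hne := (add_nat_mem_rightHalf hz (n + 1)).2
    rw [e] at hne ⊢
    exact Complex.log_ofReal_mul hn0 (right_ne_zero_of_mul hne)
  have hfact : ((n.factorial : ℝ) : ℂ) = (Stirling.stirlingSeq n : ℂ) * (√2 : ℝ) *
      Complex.exp (1 / 2 * Real.log n) * Complex.exp (n * Real.log n - n) := by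
    have h1 : (n.factorial : ℝ) = Stirling.stirlingSeq n * √2 * exp (1 / 2 * Real.log n) *
        exp (n * Real.log n - n) := by
      have e1 : exp (1 / 2 * Real.log n) = √n := by
        rw [Real.sqrt_eq_rpow, Real.rpow_def_of_pos hn0, mul_comm]
      have e2 : exp (n * Real.log n - n) = (n / exp 1) ^ n := by
        rw [Real.exp_sub, mul_comm, Real.exp_mul, Real.exp_log hn0, Real.rpow_natCast, div_pow,
          ← Real.exp_nat_mul, mul_one]
      rw [e1, e2, Stirling.stirlingSeq, Real.sqrt_mul (by norm_num)]
      have : 0 < √(n : ℝ) := Real.sqrt_pos.2 hn0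
      field_simp
    rw [h1]
    push_cast
    rfl
  have hpow : (n : ℂ) ^ (z + 1 / 2) = Complex.exp (Real.log n * (z + 1 / 2)) := by
    rw [Complex.cpow_def_of_ne_zero hnC, Complex.natCast_log]
  have hs2 : ((√2 : ℝ) : ℂ) ≠ 0 := by exact_mod_cast (Real.sqrt_pos.2 (by norm_num)).ne'
  have hspi : ((√π : ℝ) : ℂ) ≠ 0 := by exact_mod_cast (Real.sqrt_pos.2 pi_pos).ne'
  rw [Complex.GammaSeq, hP, ← Complex.ofReal_natCast n.factorial, hfact, hpow,
    gaussGamma.eq_1 (z + (n + 1 : ℕ)), Real.sqrt_mul (by norm_num), div_div_eq_mul_div]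
  have hexp : Complex.exp (z + 1 - (z + 1) * Complex.log (1 + (z + 1) / (n : ℝ)) -
        (n : ℝ) * Complex.log (1 + (z + 1) / (n : ℝ))) *
      Complex.exp (gaussRemainder (z + (n + 1 : ℕ))) *
      Complex.exp (mulLogSub (z + (n + 1 : ℕ)) - gaussRemainder (z + (n + 1 : ℕ))) =
      Complex.exp (Real.log n * (z + 1 / 2)) * Complex.exp (1 / 2 * Real.log n) *
        Complex.exp (n * Real.log n - n) := by
    rw [← Complex.exp_add, ← Complex.exp_add, ← Complex.exp_add, ← Complex.exp_add]
    congr 1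
    rw [mulLogSub, hlog]
    push_cast
    ring
  rw [div_eq_iff (mul_ne_zero (by rw [Complex.ofReal_mul]; exact mul_ne_zero hs2 hspi)
    (Complex.exp_ne_zero _))]
  push_cast at hexp hs2 hspi ⊢
  have alg : ∀ G S X Y Z E₁ E₂ E₃ a b : ℂ, b ≠ 0 → X * Y * Z = E₁ * E₂ * E₃ →
      E₁ * (S * a * E₂ * E₃) * G = G * (S / b * X * Y) * (a * b * Z) := by
    intro G S X Y Z E₁ E₂ E₃ a b hb h
    have : G * (S / b * X * Y) * (a * b * Z) = G * S * a * (X * Y * Z) := by field_simp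
    rw [this, h]
    ring
  exact alg _ _ _ _ _ _ _ _ _ _ hspi hexp

theorem Gamma_add_half_eq_gaussGamma (hz : z ∈ rightHalf) :
    Complex.Gamma (z + 1 / 2) = gaussGamma z := by
  refine tendsto_nhds_unique (Complex.GammaSeq_tendsto_Gamma (z + 1 / 2)) ?_
  have hg : Tendsto (fun x : ℝ => (x : ℂ) * ((z + 1) / (x : ℂ))) atTop (𝓝 (z + 1)) := by
    refine tendsto_const_nhds.congr' ?_
    filter_upwards [eventually_ne_atTop 0] with x hx
    have : (x : ℂ) ≠ 0 := by exact_mod_cast hx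
    field_simp
  have h1 := (Complex.tendsto_mul_log_one_add_of_tendsto hg).comp
    (tendsto_natCast_atTop_atTop (R := ℝ))
  have h0 : Tendsto (fun n : ℕ => Complex.log (1 + (z + 1) / ((n : ℝ) : ℂ))) atTop (𝓝 0) := by
    have h3 : Tendsto (fun n : ℕ => 1 + (z + 1) / ((n : ℝ) : ℂ)) atTop (𝓝 (1 + 0)) := by
      refine tendsto_const_nhds.add ?_
      have := (tendsto_inv_atTop_nhds_zero_nat (𝕜 := ℂ)).const_mul (z + 1)
      rw [mul_zero] at this
      exact this.congr fun n => by simp [div_eq_mul_inv]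
    rw [add_zero] at h3
    have := (continuousAt_clog Complex.one_mem_slitPlane).tendsto.comp h3
    rwa [Complex.log_one] at this
  have h2 : Tendsto (fun n : ℕ => ((Stirling.stirlingSeq n / √π : ℝ) : ℂ)) atTop (𝓝 1) := by
    have := (Stirling.tendsto_stirlingSeq_sqrt_pi.div_const √π).ofReal
    rwa [div_self (Real.sqrt_pos.2 pi_pos).ne', Complex.ofReal_one] at this
  have h4 := ((Complex.continuous_exp.tendsto _).comp
    ((tendsto_const_nhds (x := z + 1)).sub (h0.const_mul (z + 1)) |>.sub h1))
  have h5 := (Complex.continuous_exp.tendsto _).comp (tendsto_gaussRemainder_add_nat hz)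
  have h6 := ((h2.mul h4).mul h5).const_mul (gaussGamma z)
  simp only [mul_zero, sub_zero, sub_self, Complex.exp_zero, mul_one] at h6
  refine h6.congr' ?_
  filter_upwards [eventually_ne_atTop 0] with n hn
  rw [GammaSeq_add_half_eq hz hn]
  rfl

theorem lnGamma_add_half (hz : z ∈ rightHalf) : lnGamma (z + 1 / 2) =
    mulLogSub z + 1 / 2 * Real.log (2 * π) - gaussRemainder z := by
  have hc : ContinuousOn (fun w => lnGamma (w + 1 / 2) -
      (mulLogSub w + 1 / 2 * Real.log (2 * π) - gaussRemainder w)) rightHalf := by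
    refine (differentiableOn_lnGamma.continuousOn.comp (by fun_prop)
      fun w hw => add_half_mem_slitPlane hw).sub (ContinuousOn.sub (ContinuousOn.add ?_
        continuousOn_const) continuousOn_gaussRemainder)
    exact fun w hw => (hasDerivAt_mulLogSub
      (mem_slitPlane_of_rightHalf hw)).continuousAt.continuousWithinAt
  have h1 : (1 : ℂ) ∈ rightHalf := ⟨by simp, one_ne_zero⟩
  refine sub_eq_zero.1 (eq_zero_of_exp_eq_one isPreconnected_rightHalf hc (fun w hw => ?_) h1 ?_ hz)
  · have hsqrt : ((√(2 * π) : ℝ) : ℂ) = Complex.exp (1 / 2 * Real.log (2 * π)) := by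
      rw [Real.sqrt_eq_rpow, Real.rpow_def_of_pos (by positivity), Complex.ofReal_exp, mul_comm]
      push_cast
      rfl
    rw [Complex.exp_sub, exp_lnGamma (add_half_mem_slitPlane hw), Gamma_add_half_eq_gaussGamma hw,
      div_eq_one_iff_eq (Complex.exp_ne_zero _), gaussGamma, hsqrt, ← Complex.exp_add]
    congr 1
    ring
  · have e1 : gaussRemainder 1 =
        ((1 / 2 * ∫ u in Ioi (0 : ℝ), (beta 2 u + 1 / 12) / (u + 1) ^ 2 : ℝ) : ℂ) := by
      rw [gaussRemainder, Complex.ofReal_mul, ← integral_complex_ofReal]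
      simp only [gaussIntegrand]
      push_cast
      rfl
    have e2 := lnGamma_ofReal (x := 3 / 2) (by norm_num)
    push_cast at e2
    have e3 : (1 : ℂ) + 1 / 2 = 3 / 2 := by norm_num
    have e4 : mulLogSub 1 = ((-1 : ℝ) : ℂ) := by simp [mulLogSub]
    have e5 : (1 / 2 : ℂ) = ((1 / 2 : ℝ) : ℂ) := by norm_num
    rw [e1, e3, e2, e4, e5, ← Complex.ofReal_mul, ← Complex.ofReal_add, ← Complex.ofReal_sub,
      ← Complex.ofReal_sub, Complex.ofReal_im]

end

/-! ### The remainder R̂ as a Bernoulli integral. -/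

theorem THat_eq {j : ℕ} (hj : j ≠ 0) {z : ℂ} (hz : z ≠ 0) :
    THat j z = (2 / 2 ^ (2 * j) - 1) * ((bernoulli (2 * j) : ℚ) : ℂ) /
      (2 * (j : ℂ) * (2 * (j : ℂ) - 1) * z ^ (2 * j - 1)) := by
  obtain ⟨m, rfl⟩ := Nat.exists_eq_succ_of_ne_zero hj
  have h1 : (2 : ℂ) * (m.succ : ℂ) - 1 ≠ 0 := by
    have : (2 : ℂ) * (m.succ : ℂ) - 1 = ((2 * m + 1 : ℕ) : ℂ) := by push_cast; ring
    rw [this]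
    exact_mod_cast (2 * m).succ_ne_zero
  have h2 : (m.succ : ℂ) ≠ 0 := by exact_mod_cast m.succ_ne_zero
  have e1 : 2 * m.succ - 1 = 2 * m + 1 := by omega
  have e2 : (2 : ℂ) ^ (2 * m.succ) = 2 * 2 ^ (2 * m + 1) := by
    rw [← pow_succ']
    rfl
  rw [THat, T, T, e1, e2, mul_pow]
  field_simp

theorem R_succ {k : ℕ} (hk : 1 ≤ k) (z : ℂ) : R (k + 1) z = R k z - T k z := by
  rw [R, R, Finset.sum_Ico_succ_top hk]
  ring

theorem RHat_succ {k : ℕ} (hk : 1 ≤ k) (z : ℂ) : RHat (k + 1) z = RHat k z - THat k z := by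
  rw [RHat, RHat, THat, R_succ hk, R_succ hk]
  ring

section

variable {z : ℂ}

theorem RHat_one (hz : z ∈ rightHalf) : RHat 1 z = -gaussRemainder z := by
  have h2log : Complex.log (2 * z) = Real.log 2 + Complex.log z := by
    have := Complex.log_ofReal_mul (r := 2) (by norm_num) hz.2
    rwa [Complex.ofReal_ofNat] at this
  have h := lnGamma_two_mul (mem_slitPlane_of_rightHalf hz)
  rw [lnGamma_add_half hz, Real.log_mul two_ne_zero pi_ne_zero, mulLogSub] at h
  rw [RHat, R, R, h, h2log, Finset.Ico_self, Finset.sum_empty, Finset.sum_empty]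
  push_cast
  ring

theorem integral_inv_add_sq (hz : z ∈ rightHalf) :
    ∫ u in Ioi (0 : ℝ), ((1 / 12 : ℝ) : ℂ) / ((u : ℂ) + z) ^ 2 = 1 / (12 * z) := by
  have hz0 := hz.2
  have h := integral_Ioi_of_hasDerivWithinAt_Ioi (f := fun u : ℝ => -(1 / 12 / ((u : ℂ) + z)))
    (f' := fun u : ℝ => ((1 / 12 : ℝ) : ℂ) / ((u : ℂ) + z) ^ 2) (m := 0) ?_ ?_
    (integrableOn_div_pow (C := 1 / 12) continuous_const (fun _ => by norm_num) hz 0) ?_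
  · rw [h, Complex.ofReal_zero, zero_add, zero_sub, neg_neg, div_div]
  · refine (ContinuousOn.div (by fun_prop) (by fun_prop) fun u hu => ?_).neg
    exact (add_mem_rightHalf hz hu).2
  · intro u hu
    have hu0 := (add_mem_rightHalf hz (le_of_lt hu)).2
    refine (((hasDerivAt_const u (1 / 12 : ℂ)).div (hasDerivAt_add_ofReal z u)
      hu0).neg.congr_deriv ?_).hasDerivWithinAt
    push_cast
    field_simp
    ring
  · rw [tendsto_zero_iff_norm_tendsto_zero]
    have : Tendsto (fun u : ℝ => 1 / 12 / ‖(u : ℂ) + z‖) atTop (𝓝 0) :=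
      tendsto_const_nhds.div_atTop (tendsto_norm_add_ofReal z)
    refine this.congr fun u => ?_
    rw [norm_neg, norm_div]
    norm_num

/-- The constant 1/12 integrates to the first correction term: 1/(24z) = -T̂₁(z). -/
theorem gaussRemainder_eq (hz : z ∈ rightHalf) :
    gaussRemainder z = bernoulliIntegral 2 z / 2 + 1 / (24 * z) := by
  have hz0 := hz.2
  have e : ∀ u : ℝ, gaussIntegrand z u =
      (beta 2 u : ℂ) / ((u : ℂ) + z) ^ 2 + ((1 / 12 : ℝ) : ℂ) / ((u : ℂ) + z) ^ 2 := by
    intro u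
    rw [gaussIntegrand, Complex.ofReal_add, add_div]
  rw [gaussRemainder]
  simp_rw [e]
  rw [integral_add (integrableOn_beta_div hz (by norm_num) le_rfl)
    (integrableOn_div_pow (C := 1 / 12) continuous_const (fun _ => by norm_num) hz 0),
    integral_inv_add_sq hz, bernoulliIntegral]
  field_simp
  ring

/-- Each induction step takes two integrations by parts: the odd boundary term vanishes at the
midpoint of the Bernoulli polynomial, and the even one is T̂_{k+1}. -/
theorem RHat_succ_eq (hz : z ∈ rightHalf) {k : ℕ} (hk : 1 ≤ k) :
    RHat (k + 1) z = -(bernoulliIntegral (2 * k) z / ((2 * k : ℕ) : ℂ)) := by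
  have hz0 := hz.2
  induction k, hk using Nat.le_induction with
  | base =>
    rw [RHat_succ le_rfl, RHat_one hz, gaussRemainder_eq hz, THat_eq one_ne_zero hz0, mul_one,
      bernoulli_two]
    push_cast
    field_simp
    ring
  | succ k hk ih =>
    have hb : ((beta (2 * k + 1 + 1) 0 : ℝ) : ℂ) =
        (2 / 2 ^ (2 * (k + 1)) - 1) * ((bernoulli (2 * (k + 1)) : ℚ) : ℂ) := by
      rw [beta_zero]
      push_cast
      rfl
    rw [RHat_succ (by omega), ih, THat_eq (by omega) hz0, bernoulliIntegral_succ hz (by omega),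
      bernoulliIntegral_succ hz (by omega : 2 ≤ 2 * k + 1), beta_odd_zero, hb,
      show 2 * (k + 1) - 1 = 2 * k + 1 by omega, show 2 * k + 1 + 1 = 2 * (k + 1) by ring]
    push_cast
    rw [show 2 * ((k : ℂ) + 1) - 1 = 2 * k + 1 by ring, show (2 * (k : ℂ) + 1 + 1) = 2 * (k + 1) by ring]
    rw [mul_comm (2 * ((k : ℂ) + 1)) (2 * k + 1)]
    ring

end

/-! ### Estimates on the imaginary axis. -/

/-- `1/2 |T_j(t)|`. -/
noncomputable def halfAbsT (j : ℕ) (t : ℝ) : ℝ :=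
  |(bernoulli (2 * j) : ℝ)| / (2 * (2 * j * (2 * j - 1) * t ^ (2 * j - 1)))

section

variable {j : ℕ} {t : ℝ}

theorem two_mul_sub_one_pos (hj : 1 ≤ j) : (0 : ℝ) < 2 * j - 1 := by
  have : (1 : ℝ) ≤ j := by exact_mod_cast hj
  linarith

theorem halfAbsT_pos (hj : 1 ≤ j) (ht : 0 < t) : 0 < halfAbsT j t := by
  have h1 := two_mul_sub_one_pos hj
  have h2 : (0 : ℝ) < j := by exact_mod_cast hj
  have h3 := abs_pos.2 (bernoulli_even_ne_zero (k := j) (by omega))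
  unfold halfAbsT
  positivity

theorem mem_rightHalf_I_mul (ht : 0 < t) : Complex.I * (t : ℂ) ∈ rightHalf :=
  ⟨by simp, mul_ne_zero Complex.I_ne_zero (by exact_mod_cast ht.ne')⟩

theorem half_le_one_sub (hj : 1 ≤ j) : (1 / 2 : ℝ) ≤ 1 - 2 / 2 ^ (2 * j) := by
  have : (2 : ℝ) ^ 2 ≤ 2 ^ (2 * j) := pow_le_pow_right₀ (by norm_num) (by omega)
  have h2 : (2 : ℝ) / 2 ^ (2 * j) ≤ 2 / 2 ^ 2 := div_le_div_of_nonneg_left (by norm_num) (by norm_num) this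
  norm_num at h2
  linarith

theorem TTilde_eq (hj : 1 ≤ j) (ht : 0 < t) :
    TTilde j t = (1 - 2 / 2 ^ (2 * j)) * halfAbsT j t := by
  have h1 := two_mul_sub_one_pos hj
  have h2 : (0 : ℝ) < j := by exact_mod_cast hj
  have h3 := half_le_one_sub hj
  have e : THat j (t : ℂ) = (((2 / 2 ^ (2 * j) - 1) * (bernoulli (2 * j) : ℝ) /
      (2 * j * (2 * j - 1) * t ^ (2 * j - 1)) : ℝ) : ℂ) := by
    rw [THat_eq (by omega) (by exact_mod_cast ht.ne')]
    push_cast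
    rfl
  rw [TTilde, e, Complex.norm_real, norm_div, norm_mul, Real.norm_eq_abs, Real.norm_eq_abs,
    norm_of_nonneg (by positivity : 0 ≤ 2 * (j : ℝ) * (2 * j - 1) * t ^ (2 * j - 1)), abs_sub_comm,
    abs_of_pos (by linarith), halfAbsT]
  field_simp

theorem eta_eq (j : ℕ) : eta j = 1 / (1 - 2 / 2 ^ (2 * j)) := by
  rw [eta, zpow_sub₀ two_ne_zero, zpow_one]
  norm_cast

theorem eta_mul_TTilde (hj : 1 ≤ j) (ht : 0 < t) : eta j * TTilde j t = halfAbsT j t := by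
  have h3 := half_le_one_sub hj
  rw [eta_eq, TTilde_eq hj ht, ← mul_assoc, one_div_mul_cancel (by linarith), one_mul]

theorem TTilde_pos (hj : 1 ≤ j) (ht : 0 < t) : 0 < TTilde j t := by
  rw [TTilde_eq hj ht]
  exact mul_pos (by linarith [half_le_one_sub hj]) (halfAbsT_pos hj ht)

theorem TTilde_le (hj : 1 ≤ j) (ht : 0 < t) : TTilde j t ≤ halfAbsT j t := by
  rw [TTilde_eq hj ht]
  refine mul_le_of_le_one_left (halfAbsT_pos hj ht).le ?_
  have : (0 : ℝ) ≤ 2 / 2 ^ (2 * j) := by positivity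
  linarith

/-- The sign of i^{-(2j-1)} cancels the alternating sign of B_{2j} and the negative factor 2^{1-2j}
- 1, so every term contributes positively. -/
theorem im_half_THat (hj : 1 ≤ j) (ht : 0 < t) :
    (1 / 2 * THat j (Complex.I * (t : ℂ))).im = TTilde j t := by
  have h1 := two_mul_sub_one_pos hj
  have h2 : (0 : ℝ) < j := by exact_mod_cast hj
  have ht' : (t : ℂ) ≠ 0 := by exact_mod_cast ht.ne'
  have hsign : (Complex.I ^ (2 * j - 1))⁻¹ = -((-1) ^ (j + 1) : ℝ) * Complex.I := by
    obtain ⟨m, rfl⟩ := Nat.exists_eq_add_of_le' hj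
    rw [show 2 * (m + 1) - 1 = 2 * m + 1 by omega, pow_succ, pow_mul, Complex.I_sq, mul_inv,
      Complex.inv_I, ← inv_pow]
    push_cast
    rw [inv_neg, inv_one]
    ring
  have e : 1 / 2 * THat j (Complex.I * (t : ℂ)) = ((TTilde j t : ℝ) : ℂ) * Complex.I := by
    rw [THat_eq (by omega) (mul_ne_zero Complex.I_ne_zero ht'), TTilde_eq hj ht, halfAbsT,
      abs_bernoulli_even (by omega), mul_pow]
    have e1 : ∀ a b x y : ℂ, a / (b * (x * y)) = a / (b * y) * x⁻¹ := by
      intro a b x y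
      rw [div_eq_mul_inv, div_eq_mul_inv, mul_inv, mul_inv, mul_inv]
      ring
    rw [e1, hsign]
    have h1' : (2 * (j : ℂ) - 1) ≠ 0 := by exact_mod_cast h1.ne'
    have h2' : (j : ℂ) ≠ 0 := by exact_mod_cast h2.ne'
    push_cast
    field_simp
    ring
  rw [e]
  generalize TTilde j t = a
  simp

theorem RTilde_eq_add (hj : 1 ≤ j) (ht : 0 < t) :
    RTilde j t = TTilde j t + RTilde (j + 1) t := by
  rw [RTilde, RTilde, RHat_succ hj, mul_sub, Complex.sub_im, im_half_THat hj ht]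
  ring

theorem RTilde_one_eq (k : ℕ) (ht : 0 < t) :
    RTilde 1 t = ∑ j ∈ Finset.Icc 1 k, TTilde j t + RTilde (k + 1) t := by
  induction k with
  | zero => simp
  | succ k ih =>
    rw [Finset.sum_Icc_succ_top (by omega), ih, RTilde_eq_add (by omega : 1 ≤ k + 1) ht]
    ring

theorem abs_RTilde_succ_le (hj : 1 ≤ j) (ht : 0 < t) :
    |RTilde (j + 1) t| ≤ gammaRatio j * halfAbsT j t := by
  have hz := mem_rightHalf_I_mul ht
  have h1 := two_mul_sub_one_pos hj
  have h2 : (0 : ℝ) < j := by exact_mod_cast hj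
  have hn : ‖Complex.I * (t : ℂ)‖ = t := by
    rw [norm_mul, Complex.norm_I, one_mul, Complex.norm_real, norm_of_nonneg ht.le]
  have hb := norm_bernoulliIntegral_even_le hz (k := j) (by omega)
  rw [hn] at hb
  have hi := integral_inv_sq_add_sq_pow ht (j := j) (by omega)
  rw [RTilde, RHat_succ_eq hz hj]
  refine (Complex.abs_im_le_norm _).trans ?_
  rw [norm_mul, norm_neg, norm_div (bernoulliIntegral _ _), Complex.norm_natCast, ← hi, halfAbsT]
  push_cast
  set A := ∫ u in Ioi (0 : ℝ), ((u ^ 2 + t ^ 2) ^ j)⁻¹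
  calc ‖(1 / 2 : ℂ)‖ * (‖bernoulliIntegral (2 * j) (Complex.I * (t : ℂ))‖ / (2 * j)) ≤
      1 / 2 * (|(bernoulli (2 * j) : ℝ)| * A / (2 * j)) := by
        have : ‖(1 / 2 : ℂ)‖ = 1 / 2 := by norm_num
        rw [this]
        gcongr
    _ = _ := by field_simp

theorem halfAbsT_succ_le (hj : 1 ≤ j) (ht : 0 < t) :
    halfAbsT (j + 1) t ≤ j * (j - 1 / 2) / (π * t) ^ 2 * halfAbsT j t := by
  have h1 := two_mul_sub_one_pos hj
  have h2 : (0 : ℝ) < j := by exact_mod_cast hj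
  have hb := abs_bernoulli_even_succ_le (k := j) (by omega)
  have e : 2 * (j + 1) - 1 = (2 * j - 1) + 2 := by omega
  rw [halfAbsT, halfAbsT, e, pow_add]
  push_cast
  set p := t ^ (2 * j - 1) with hp
  have hp0 : 0 < p := pow_pos ht _
  set b := |(bernoulli (2 * j) : ℝ)|
  set b' := |(bernoulli (2 * (j + 1)) : ℝ)|
  have e1 : j * (j - 1 / 2) / (π * t) ^ 2 * (b / (2 * (2 * j * (2 * j - 1) * p))) =
      (2 * j + 2) * (2 * j + 1) * b / ((2 * π) ^ 2 * (2 * ((2 * j + 2) * (2 * j + 1) * (p * t ^ 2)))) := by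
    have e3 : (2 * j - 1 : ℝ) = 2 * (j - 1 / 2) := by ring
    have h3 : (j - 1 / 2 : ℝ) ≠ 0 := by linarith
    rw [e3]
    generalize (j - 1 / 2 : ℝ) = x at *
    field_simp
  have e2 : b' / (2 * (2 * ((j : ℝ) + 1) * (2 * (j + 1) - 1) * (p * t ^ 2))) =
      (2 * π) ^ 2 * b' / ((2 * π) ^ 2 * (2 * ((2 * j + 2) * (2 * j + 1) * (p * t ^ 2)))) := by
    rw [mul_div_mul_left _ _ (by positivity)]
    congr 1
    ring
  rw [e1, e2]
  exact div_le_div_of_nonneg_right hb (by positivity)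

theorem abs_RTilde_lt_sqrt (hj : 1 ≤ j) (ht : 0 < t) :
    |RTilde (j + 1) t| < eta j * √(π * j) * TTilde j t := by
  rw [mul_right_comm, eta_mul_TTilde hj ht, mul_comm]
  exact (abs_RTilde_succ_le hj ht).trans_lt
    (mul_lt_mul_of_pos_right (gammaRatio_lt_sqrt (by omega)) (halfAbsT_pos hj ht))

theorem abs_RTilde_lt_of_le (hj : 1 ≤ j) (ht : (j : ℝ) ≤ t) :
    |RTilde (j + 1) t| < eta j * ((j / t) ^ 2 / (π ^ 2 - 1)) * TTilde j t := by
  have ht0 : 0 < t := lt_of_lt_of_le (by exact_mod_cast hj) ht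
  rw [mul_right_comm, eta_mul_TTilde hj ht0, mul_comm, ← div_lt_iff₀ (halfAbsT_pos hj ht0)]
  -- Normalizing by |T_j|/2 rather than T̃_j keeps the powers of 2 out of the recurrence; η_j
  -- restores them at the end.
  refine lt_of_recurrence (a := fun j => |RTilde (j + 1) t| / halfAbsT j t) hj ht
    (fun i hi => div_nonneg (abs_nonneg _) (halfAbsT_pos hi ht0).le) (fun i hi => ?_) (fun i hi => ?_)
  · have hV := halfAbsT_pos hi ht0
    have hV' := halfAbsT_pos (by omega : 1 ≤ i + 1) ht0
    have hT := TTilde_pos (by omega : 1 ≤ i + 1) ht0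
    have hT' := TTilde_le (by omega : 1 ≤ i + 1) ht0
    rw [div_le_iff₀ hV]
    have h1 : |RTilde (i + 1) t| ≤ halfAbsT (i + 1) t + |RTilde (i + 1 + 1) t| := by
      rw [RTilde_eq_add (by omega : 1 ≤ i + 1) ht0]
      refine (abs_add_le _ _).trans ?_
      rw [abs_of_pos hT]
      linarith
    have h2 : halfAbsT (i + 1) t + |RTilde (i + 1 + 1) t| =
        halfAbsT (i + 1) t * (1 + |RTilde (i + 1 + 1) t| / halfAbsT (i + 1) t) := by
      field_simp
    rw [mul_right_comm]
    refine (h1.trans_eq h2).trans ?_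
    exact mul_le_mul_of_nonneg_right (halfAbsT_succ_le hi ht0)
      (add_nonneg zero_le_one (div_nonneg (abs_nonneg _) hV'.le))
  · exact (div_le_iff₀ (halfAbsT_pos hi ht0)).2 (abs_RTilde_succ_le hi ht0)

theorem theta_eq_thetaApprox_add (k : ℕ) (ht : 0 < t) :
    theta t = thetaApprox k t + 1 / 2 * arctan (exp (-(π * t))) + RTilde (k + 1) t := by
  have hz := mem_rightHalf_I_mul ht
  have h1 := RTilde_one_eq k ht
  rw [RTilde, RHat_one hz] at h1
  have h2 := congrArg Complex.im (lnGamma_add_half hz)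
  -- log(it) = log t + iπ/2, so the π/2 contributes only to the real part.
  have hlog : mulLogSub (Complex.I * (t : ℂ)) =
      ((-(π / 2 * t) : ℝ) : ℂ) + ((t * Real.log t - t : ℝ) : ℂ) * Complex.I := by
    rw [mulLogSub, Complex.log_mul_ofReal t ht _ Complex.I_ne_zero, Complex.log_I]
    push_cast
    linear_combination (π / 2 * t : ℂ) * Complex.I_sq
  have h3 : (1 / 2 * ((Real.log (2 * π) : ℝ) : ℂ)).im = 0 := by
    generalize Real.log (2 * π) = a
    simp
  have h4 : (1 / 2 * -gaussRemainder (Complex.I * (t : ℂ))).im =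
      -(1 / 2 * (gaussRemainder (Complex.I * (t : ℂ))).im) := by
    simp
  have h5 : (((-(π / 2 * t) : ℝ) : ℂ) + ((t * Real.log t - t : ℝ) : ℂ) * Complex.I).im =
      t * Real.log t - t := by
    generalize t * Real.log t - t = a
    simp
  rw [Complex.sub_im, Complex.add_im, hlog, h3, h5] at h2
  rw [h4] at h1
  rw [theta_eq, thetaApprox, h2, Real.log_div ht.ne' (by positivity),
    Real.log_mul (by positivity) (exp_pos 1).ne', Real.log_exp]
  linarith

theorem arctan_lt_self {x : ℝ} (hx : 0 < x) : arctan x < x := by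
  have h := Real.lt_tan (arctan_pos.2 hx) (arctan_lt_pi_div_two x)
  rwa [tan_arctan] at h

end

end SiegelTheta

theorem mainTheorem10 (k : ℕ) (hk : 1 ≤ k) (t : ℝ) (ht : 0 < t) :
    |SiegelTheta.RTilde (k + 1) t / SiegelTheta.TTilde k t|
        < SiegelTheta.eta k * Real.sqrt (Real.pi * k) ∧
    ((k : ℝ) ≤ t →
      |SiegelTheta.RTilde (k + 1) t / SiegelTheta.TTilde k t|
        < SiegelTheta.eta k * (((k : ℝ) / t) ^ 2 / (Real.pi ^ 2 - 1))) ∧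
    SiegelTheta.theta t = SiegelTheta.thetaApprox k t
        + 1 / 2 * Real.arctan (Real.exp (-(Real.pi * t))) + SiegelTheta.RTilde (k + 1) t ∧
    |SiegelTheta.theta t - SiegelTheta.thetaApprox k t|
        < |SiegelTheta.RTilde (k + 1) t| + 1 / 2 * Real.exp (-(Real.pi * t)) ∧
    |SiegelTheta.theta t - SiegelTheta.thetaApprox k t|
        < SiegelTheta.eta k * Real.sqrt (Real.pi * k) * SiegelTheta.TTilde k t
          + 1 / 2 * Real.exp (-(Real.pi * t)) ∧
    ((k : ℝ) ≤ t →
      |SiegelTheta.theta t - SiegelTheta.thetaApprox k t|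
        < SiegelTheta.eta k * (((k : ℝ) / t) ^ 2 / (Real.pi ^ 2 - 1)) * SiegelTheta.TTilde k t
          + 1 / 2 * Real.exp (-(Real.pi * t))) := by
  have hT := SiegelTheta.TTilde_pos hk ht
  have h1 := SiegelTheta.abs_RTilde_lt_sqrt hk ht
  have h2 := fun h => SiegelTheta.abs_RTilde_lt_of_le (t := t) hk h
  have h3 := SiegelTheta.theta_eq_thetaApprox_add k ht
  have h4 : |SiegelTheta.theta t - SiegelTheta.thetaApprox k t|
      < |SiegelTheta.RTilde (k + 1) t| + 1 / 2 * Real.exp (-(Real.pi * t)) := by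
    have h5 := SiegelTheta.arctan_lt_self (Real.exp_pos (-(Real.pi * t)))
    have h6 := Real.arctan_pos.2 (Real.exp_pos (-(Real.pi * t)))
    have e : SiegelTheta.theta t - SiegelTheta.thetaApprox k t = SiegelTheta.RTilde (k + 1) t +
        1 / 2 * Real.arctan (Real.exp (-(Real.pi * t))) := by
      rw [h3]
      ring
    rw [e]
    refine (abs_add_le _ _).trans_lt ?_
    rw [abs_of_pos (by positivity : 0 < 1 / 2 * Real.arctan (Real.exp (-(Real.pi * t))))]
    linarith
  refine ⟨?_, fun h => ?_, h3, h4, by linarith, fun h => by linarith [h2 h]⟩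
  · rwa [abs_div, abs_of_pos hT, div_lt_iff₀ hT]
  · rw [abs_div, abs_of_pos hT, div_lt_iff₀ hT]
    exact h2 h
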